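/- Let $M\ge 1$, let $\rho_1>\rho_2>\dots>\rho_M>0$ be real numbers, let $f:\mathbb R\to\mathbb R$ be convex with $c_1|z|^2+c_0\le f(z)\le c_2|z|^2+c_3$ for all $z\in\mathbb R$, where $c_0,c_1,c_2,c_3\in\mathbb R$ and $c_1,c_2>0$, and let $(a,b)$ be a bounded nonempty open interval. For $\varepsilon>0$ and $u:\varepsilon\mathbb Z\to\mathbb R$ with $u=0$ at the points of $\varepsilon\mathbb Z$ outside $(a,b)$, write $u_k=u(\varepsilon k)$ and $$(u'_{\rho_\varepsilon})_k=\frac1\varepsilon\Bigl(\sum_{j=1}^M (u_{k+j}-u_k)\rho_j-\sum_{j=1}^M(u_{k-j+1}-u_k)\rho_j\Bigr),\qquad k\in\mathbb Z.$$ If $f(0)=0$, put $$F_\varepsilon(u)=\sum_{k\in\mathbb Z}\varepsilon f\bigl((u'_{\rho_\varepsilon})_k\bigr)$$ (a sum with finitely many nonzero terms). For arbitrary $f(0)$, put $$F^{a,b}_\varepsilon(u)=\sum_{k\in Z_\varepsilon}\varepsilon f\bigl((u'_{\rho_\varepsilon})_k\bigr),$$ where $Z_\varepsilon$ is the finite set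 of those $k\in\mathbb Z$ for which some $j$ with $k-M+1\le j\le k+M$ satisfies $\varepsilon j\in(a,b)$; for $k\notin Z_\varepsilon$ one has $(u'_{\rho_\varepsilon})_k=0$, so $F^{a,b}_\varepsilon=F_\varepsilon$ if $f(0)=0$. Identify each such $u$ with its piecewise-constant interpolation (equal to $u_k$ on $[\varepsilon k,\varepsilon(k+1))$), or with its piecewise-affine interpolation, and extend the energies by $+\infty$ to the functions of $L^2(\mathbb R)$ that are not interpolations of such a $u$. Then, for either choice of interpolation, the (sequential) $\Gamma$-limit as $\varepsilon\to0^+$ of $F^{a,b}_\varepsilon$, and of $F_\varepsilon$ if $f(0)=0$, with respect to weak convergence in $L^2(\mathbb R)$ exists and equals $$F(u)=\begin{cases}\displaystyle\int_{(a,b)}f(Ku')\,dt & \text{if } u\in H^1_0(a,b)\ (\text{extended by }0),\\ +\infty&\text{otherwise in }L^2(\mathbb R),\end{cases}\qquad K=\sum_{j=1}^M(2j-1)\rho_j.$$ That is, for every sequence $\varepsilon_n\to0^+$ and every $u\in L^2(\mathbb R)$, the liminf inequality holds along every sequence converging weakly to $u$, and there is a recovery sequence for $u$. Moreover the energies $F^{a,b}_\varepsilon$,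 and $F_\varepsilon$ if $f(0)=0$, are equicoercive in $H^1$: for every $C\in\mathbb R$ there is $R$ such that, for all $0<\varepsilon<\frac1{2M}$ and all $u$ as above with energy at most $C$, the piecewise-affine interpolation $\hat u$ of $u$ belongs to $H^1(\mathbb R)$ and $\int_{\mathbb R}|\hat u|^2dx+\int_{\mathbb R}|\hat u'|^2dx\le R$. -/

import Mathlib

open MeasureTheory Filter Topology Set
open scoped ENNReal ContDiff

noncomputable section

namespace NonlocalGradient

/-! ### Lattice functions

A function on `ε ℤ` is represented by `u : ℤ → ℝ`, where `u k` is its value at the point `ε k`. -/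

/-- The discrete nonlocal gradient at scale `ε`, at the point `ε k`. -/
def grad (M : ℕ) (ρ : ℕ → ℝ) (ε : ℝ) (u : ℤ → ℝ) (k : ℤ) : ℝ :=
  (1 / ε) * (∑ j ∈ Finset.Icc 1 M, (u (k + j) - u k) * ρ j
    - ∑ j ∈ Finset.Icc 1 M, (u (k - j + 1) - u k) * ρ j)

/-- The function on `ε ℤ` vanishes at the lattice points outside `(a, b)`. -/
def VanishesOutside (a b ε : ℝ) (u : ℤ → ℝ) : Prop :=
  ∀ k : ℤ, ε * k ∉ Ioo a b → u k = 0

/-- The energy `∑_{k ∈ S} ε f((u'_{ρ_ε})_k)`. -/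
def energy (M : ℕ) (ρ : ℕ → ℝ) (f : ℝ → ℝ) (S : Set ℤ) (ε : ℝ) (u : ℤ → ℝ) : ℝ :=
  ∑' k : S, ε * f (grad M ρ ε u k)

/-- The sites `k` whose nonlocal gradient involves the value of the function at some lattice point
of `(a, b)`. At all other sites the gradient of a function vanishing outside `(a, b)` is zero. -/
def activeSites (M : ℕ) (a b ε : ℝ) : Set ℤ :=
  {k | ∃ j : ℤ, k - M + 1 ≤ j ∧ j ≤ k + M ∧ ε * j ∈ Ioo a b}

/-- The sum of `ε f((u'_{ρ_ε})_k)` over all `k ∈ ℤ`. -/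
def fullEnergy (M : ℕ) (ρ : ℕ → ℝ) (f : ℝ → ℝ) (ε : ℝ) (u : ℤ → ℝ) : ℝ :=
  energy M ρ f Set.univ ε u

/-- The sum of `ε f((u'_{ρ_ε})_k)` over the sites `k` at which the gradient involves `(a, b)`. -/
def activeEnergy (M : ℕ) (ρ : ℕ → ℝ) (f : ℝ → ℝ) (a b ε : ℝ) (u : ℤ → ℝ) : ℝ :=
  energy M ρ f (activeSites M a b ε) ε u

theorem grad_eq_zero {M : ℕ} {ρ : ℕ → ℝ} {a b ε : ℝ} (hM : 1 ≤ M) {u : ℤ → ℝ}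
    (hu : VanishesOutside a b ε u) {k : ℤ} (hk : k ∉ activeSites M a b ε) :
    grad M ρ ε u k = 0 := by
  have h0 : ∀ j : ℤ, k - M + 1 ≤ j → j ≤ k + M → u j = 0 := fun j h1 h2 =>
    hu j fun h => hk ⟨j, h1, h2, h⟩
  have hk0 : u k = 0 := h0 k (by omega) (by omega)
  unfold grad
  rw [Finset.sum_eq_zero, Finset.sum_eq_zero]
  · simp
  · intro j hj
    rw [Finset.mem_Icc] at hj
    rw [h0 (k - j + 1) (by omega) (by omega), hk0]; simp
  · intro j hj
    rw [Finset.mem_Icc] at hj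
    rw [h0 (k + j) (by omega) (by omega), hk0]; simp

theorem activeSites_finite (M : ℕ) (a b : ℝ) {ε : ℝ} (hε : 0 < ε) :
    (activeSites M a b ε).Finite := by
  refine (Set.finite_Icc (⌊a / ε⌋ - M) (⌈b / ε⌉ + M)).subset ?_
  rintro k ⟨j, h1, h2, h3, h4⟩
  have h5 : a / ε < j := by rw [div_lt_iff₀ hε]; linarith
  have h6 : (j : ℝ) < b / ε := by rw [lt_div_iff₀ hε]; linarith
  have h7 : ⌊a / ε⌋ ≤ j := Int.cast_le.1 ((Int.floor_le _).trans h5.le)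
  have h8 : j ≤ ⌈b / ε⌉ := Int.cast_le.1 (h6.le.trans (Int.le_ceil _))
  constructor <;> omega

/-- If `f 0 = 0`, the sum over all of `ℤ` has finitely many nonzero terms and equals the sum over
the active sites. -/
theorem fullEnergy_eq_activeEnergy {M : ℕ} {ρ : ℕ → ℝ} {f : ℝ → ℝ} {a b ε : ℝ} (hM : 1 ≤ M)
    (hf : f 0 = 0) {u : ℤ → ℝ} (hu : VanishesOutside a b ε u) :
    fullEnergy M ρ f ε u = activeEnergy M ρ f a b ε u := by
  unfold fullEnergy activeEnergy energy
  rw [tsum_univ (fun k : ℤ => ε * f (grad M ρ ε u k))]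
  symm
  refine tsum_subtype_eq_of_support_subset (f := fun k : ℤ => ε * f (grad M ρ ε u k)) ?_
  intro k hk
  by_contra h
  exact hk (by simp [grad_eq_zero hM hu h, hf])

/-! ### Interpolations -/

/-- Piecewise-constant interpolation: the value on `[ε k, ε (k + 1))` is `u k`. -/
def pcInterp (ε : ℝ) (u : ℤ → ℝ) (x : ℝ) : ℝ := u ⌊x / ε⌋

/-- Piecewise-affine interpolation of the values `u k` at the points `ε k`. -/
def paInterp (ε : ℝ) (u : ℤ → ℝ) (x : ℝ) : ℝ :=
  u ⌊x / ε⌋ + Int.fract (x / ε) * (u (⌊x / ε⌋ + 1) - u ⌊x / ε⌋)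

/-! ### Sobolev functions on the line -/

/-- `g` is a weak derivative of `u` on `ℝ`. -/
def IsWeakDeriv (u g : ℝ → ℝ) : Prop :=
  LocallyIntegrable u volume ∧ LocallyIntegrable g volume ∧
    ∀ φ : ℝ → ℝ, ContDiff ℝ ∞ φ → HasCompactSupport φ →
      ∫ x, u x * deriv φ x = - ∫ x, g x * φ x

open scoped Classical in
/-- The weak derivative in `L²(ℝ)`, well defined up to a null set, for `u` that has one
(and `0` otherwise). -/
def weakDeriv (u : ℝ → ℝ) : ℝ → ℝ :=
  if h : ∃ g : ℝ → ℝ, MemLp g 2 volume ∧ IsWeakDeriv u g then h.choose else 0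

/-- `u`, extended by zero outside `(a, b)`, belongs to `H¹₀(a, b)`, the closure of
`C_c^∞(a, b)` in the `H¹` norm. -/
def MemH10 (a b : ℝ) (u : ℝ → ℝ) : Prop :=
  MemLp u 2 volume ∧ ∃ g : ℝ → ℝ, MemLp g 2 volume ∧ IsWeakDeriv u g ∧
    ∃ φ : ℕ → ℝ → ℝ,
      (∀ n, ContDiff ℝ ∞ (φ n) ∧ HasCompactSupport (φ n) ∧ tsupport (φ n) ⊆ Ioo a b) ∧
      Tendsto (fun n => eLpNorm (φ n - u) 2 volume) atTop (𝓝 0) ∧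
      Tendsto (fun n => eLpNorm (deriv (φ n) - g) 2 volume) atTop (𝓝 0)

/-! ### Γ-convergence -/

/-- `F₀` is the Γ-limit of `F ε` as `ε → 0⁺` with respect to weak (sequential) convergence in `H`:
along every sequence `ε n → 0⁺` the liminf inequality holds and recovery sequences exist. -/
def IsWeakGammaLimit {H : Type*} [NormedAddCommGroup H] [NormedSpace ℝ H]
    (F : ℝ → H → EReal) (F₀ : H → EReal) : Prop :=
  ∀ ε : ℕ → ℝ, (∀ n, 0 < ε n) → Tendsto ε atTop (𝓝 0) → ∀ w : H,
    (∀ v : ℕ → H,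
      Tendsto (fun n => toWeakSpace ℝ H (v n)) atTop (𝓝 (toWeakSpace ℝ H w)) →
        F₀ w ≤ liminf (fun n => F (ε n) (v n)) atTop) ∧
    ∃ v : ℕ → H,
      Tendsto (fun n => toWeakSpace ℝ H (v n)) atTop (𝓝 (toWeakSpace ℝ H w)) ∧
        limsup (fun n => F (ε n) (v n)) atTop ≤ F₀ w

/-- A discrete energy `E ε u`, seen as a functional on `L²(ℝ)`: it is `E ε u` at the interpolation
`I ε u` of a lattice function `u` vanishing outside `(a, b)`, and `+∞` at all other functions. -/
def onL2 (a b : ℝ) (I : ℝ → (ℤ → ℝ) → ℝ → ℝ) (E : ℝ → (ℤ → ℝ) → ℝ) (ε : ℝ)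
    (w : Lp ℝ 2 (volume : Measure ℝ)) : EReal :=
  ⨅ (u : ℤ → ℝ) (_ : VanishesOutside a b ε u ∧ I ε u =ᵐ[volume] w), (E ε u : EReal)

open scoped Classical in
/-- The functional `∫_{(a,b)} f(K u') dt` with domain `H¹₀(a, b)`, and `+∞` elsewhere in `L²(ℝ)`. -/
def limitFunctional (f : ℝ → ℝ) (K a b : ℝ) (w : Lp ℝ 2 (volume : Measure ℝ)) : EReal :=
  if MemH10 a b w then ((∫ t in Ioo a b, f (K * weakDeriv w t) : ℝ) : EReal) else ⊤

/-- Equicoercivity in `H¹` of the discrete energies `E ε` for `0 < ε < ε₀`: a bound on the energy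
gives a bound, independent of `ε`, on the `H¹(ℝ)` norm of the piecewise-affine interpolation. -/
def EquicoerciveH1 (a b ε₀ : ℝ) (E : ℝ → (ℤ → ℝ) → ℝ) : Prop :=
  ∀ C : ℝ, ∃ R : ℝ, ∀ ε : ℝ, 0 < ε → ε < ε₀ → ∀ u : ℤ → ℝ, VanishesOutside a b ε u →
    E ε u ≤ C →
      ∃ g : ℝ → ℝ, IsWeakDeriv (paInterp ε u) g ∧
        MemLp (paInterp ε u) 2 volume ∧ MemLp g 2 volume ∧
        (∫ x, paInterp ε u x ^ 2) + (∫ x, g x ^ 2) ≤ R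

end NonlocalGradient

end

/-!
Write `D k = (u (k + 1) - u k) / ε` for the forward difference quotient, `prim g` for the primitive
of `g` that vanishes at `-∞`, and `K = ∑ (2 j - 1) ρ j`. The nonlocal gradient is a symmetric
weighted sum of translates of `D`, with total weight `K` (`pcInterp_grad_eq`, `sum_weights_eq`), and
the piecewise-affine interpolation of `u` is the primitive of the piecewise-constant interpolation
of `D` (`VanishesOutside.paInterp_eq_prim`).

*Coercivity.* Summation by parts in `j` writes the nonlocal gradient as a combination, with the
positive coefficients `ρ j - ρ (j + 1)` and `ρ M`, of convolutions of `D` with the triangular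
kernels `𝟙_{[0, m)} ⋆ 𝟙_{(-m, 0]}`. These are positive definite (`tsum_diff_mul_sum_eq`) and the one with
`m = 1` is the identity, so pairing the nonlocal gradient with `D` bounds the `ℓ²` norm of `D`
(`exists_coercive`). With the quadratic lower bound on `f` this controls the `L²` norm of the
derivative of the interpolation by the energy (`exists_bound_diffQuot`), and the Poincaré inequality
gives equicoercivity.

*The space `H¹₀(a, b)`.* Its elements are the primitives of the square-integrable functions which
vanish outside `(a, b)` and have zero mean (`IsGradOn`, `MemH10.exists_isGradOn`,
`IsGradOn.memH10`).

*Liminf inequality.* If it fails at `w`, the energies stay below some `c < F₀ w` on an unbounded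
set of indices. Along an ultrafilter containing this set the bounded functions `D` have a weak limit
`g`; the interpolations then converge weakly to `prim g`, so `w = prim g` belongs to `H¹₀(a, b)`,
and by continuity of translations in `L²` the nonlocal gradients converge weakly to `K g`. Let `s`
be a measurable selection of subgradients of `f`, of linear growth. Integrating
`f G ≥ f (K g) + s (K g) (G - K g)`, where `G` is the nonlocal gradient, gives
`∫ f (K g) ≤ c`, a contradiction (`exists_isGradOn_of_energy_le`). To avoid boundary terms, the
constant `f 0` is split off from the energy (`activeEnergy_eq`); its contribution is `f 0` times the
length of the active cells, which tends to `b - a`.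

*Recovery sequences.* For `w = prim g` one samples the continuous representative `prim g` at the
lattice points. The nonlocal gradients of the samples are weighted averages of `K g`, and by
Jensen's inequality the energy is at most `∫ f (K g)`, up to the contribution of `f 0`
(`activeEnergy_sample_le`). The interpolations even converge strongly, by the Hölder continuity of
`prim g`.
-/

open MeasureTheory Filter Topology Set
open scoped ENNReal ContDiff

noncomputable section

namespace NonlocalGradient

/-! ### Square-integrable functions -/

theorem integrable_mul_of_memLp_two {α : Type*} [MeasurableSpace α] {μ : Measure α} {f g : α → ℝ}
    (hf : MemLp f 2 μ) (hg : MemLp g 2 μ) : Integrable (fun x => f x * g x) μ :=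
  hf.integrable_mul hg

theorem inner_toLp_toLp {α : Type*} [MeasurableSpace α] {μ : Measure α} {f g : α → ℝ}
    (hf : MemLp f 2 μ) (hg : MemLp g 2 μ) :
    inner ℝ (hf.toLp f) (hg.toLp g) = ∫ x, f x * g x ∂μ := by
  rw [L2.inner_def]
  refine integral_congr_ae ?_
  filter_upwards [hf.coeFn_toLp, hg.coeFn_toLp] with x h1 h2
  simp [h1, h2, mul_comm]

theorem norm_sq_toLp {α : Type*} [MeasurableSpace α] {μ : Measure α} {f : α → ℝ}
    (hf : MemLp f 2 μ) : ‖hf.toLp f‖ ^ 2 = ∫ x, f x ^ 2 ∂μ := by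
  rw [← real_inner_self_eq_norm_sq, inner_toLp_toLp hf hf]
  simp only [sq]

theorem integral_sq_nonneg {α : Type*} [MeasurableSpace α] (μ : Measure α) (f : α → ℝ) :
    0 ≤ ∫ x, f x ^ 2 ∂μ :=
  integral_nonneg fun _ => sq_nonneg _

theorem eLpNorm_two_eq {α : Type*} [MeasurableSpace α] {μ : Measure α} {f : α → ℝ}
    (hf : MemLp f 2 μ) : eLpNorm f 2 μ = ENNReal.ofReal (√(∫ x, f x ^ 2 ∂μ)) := by
  rw [← norm_sq_toLp hf, Real.sqrt_sq (norm_nonneg _), Lp.norm_toLp,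
    ENNReal.ofReal_toReal hf.2.ne]

/-- The Cauchy–Schwarz inequality. -/
theorem sq_integral_mul_le {α : Type*} [MeasurableSpace α] {μ : Measure α} {f g : α → ℝ}
    (hf : MemLp f 2 μ) (hg : MemLp g 2 μ) :
    (∫ x, f x * g x ∂μ) ^ 2 ≤ (∫ x, f x ^ 2 ∂μ) * ∫ x, g x ^ 2 ∂μ := by
  rw [← inner_toLp_toLp hf hg, ← norm_sq_toLp hf, ← norm_sq_toLp hg, ← mul_pow]
  exact sq_le_sq' (neg_le_of_abs_le (abs_real_inner_le_norm _ _))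
    (real_inner_le_norm _ _)

theorem memLp_indicator_one {α : Type*} [MeasurableSpace α] {μ : Measure α} {s : Set α}
    (hs : MeasurableSet s) (hμ : μ s ≠ ⊤) : MemLp (s.indicator fun _ => (1 : ℝ)) 2 μ :=
  memLp_indicator_const 2 hs 1 (Or.inr hμ)

theorem setIntegral_eq_integral_mul_indicator {α : Type*} [MeasurableSpace α] {μ : Measure α}
    {s : Set α} (hs : MeasurableSet s) (g : α → ℝ) :
    ∫ x in s, g x ∂μ = ∫ x, g x * s.indicator (fun _ => (1 : ℝ)) x ∂μ := by
  rw [← integral_indicator hs]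
  refine integral_congr_ae (Eventually.of_forall fun x => ?_)
  by_cases hx : x ∈ s <;> simp [hx]

theorem sq_setIntegral_le {α : Type*} [MeasurableSpace α] {μ : Measure α} {s : Set α}
    (hs : MeasurableSet s) (hμ : μ s ≠ ⊤) {g : α → ℝ} (hg : MemLp g 2 μ) :
    (∫ x in s, g x ∂μ) ^ 2 ≤ μ.real s * ∫ x, g x ^ 2 ∂μ := by
  rw [setIntegral_eq_integral_mul_indicator hs, mul_comm (μ.real s)]
  refine (sq_integral_mul_le hg (memLp_indicator_one hs hμ)).trans_eq ?_
  congr 1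
  have : (fun x => s.indicator (fun _ => (1 : ℝ)) x ^ 2) = s.indicator fun _ => (1 : ℝ) := by
    ext x; by_cases hx : x ∈ s <;> simp [hx]
  rw [this, integral_indicator hs]
  simp

/-- Bounded families in `L²` have weak limits along ultrafilters (the Banach–Alaoglu theorem
together with the Riesz representation theorem). -/
theorem exists_weak_limit {ι : Type*} (l : Ultrafilter ι) {D : ι → ℝ → ℝ} {R : ℝ}
    (hD : ∀ i, MemLp (D i) 2 volume) (hR : ∀ i, ∫ x, D i x ^ 2 ≤ R) :
    ∃ g : ℝ → ℝ, MemLp g 2 volume ∧ ∀ h : ℝ → ℝ, MemLp h 2 volume →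
      Tendsto (fun i => ∫ x, D i x * h x) l (𝓝 (∫ x, g x * h x)) := by
  set T : ι → WeakDual ℝ (Lp ℝ 2 (volume : Measure ℝ)) := fun i =>
    StrongDual.toWeakDual (InnerProductSpace.toDual ℝ _ ((hD i).toLp (D i))) with hT
  have hc := WeakDual.isCompact_closedBall (𝕜 := ℝ) (E := Lp ℝ 2 (volume : Measure ℝ)) 0 (√R)
  have hmem : ∀ i, T i ∈ WeakDual.toStrongDual ⁻¹' Metric.closedBall
      (0 : StrongDual ℝ (Lp ℝ 2 (volume : Measure ℝ))) (√R) := by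
    intro i
    simp only [mem_preimage, mem_closedBall_zero_iff, hT, StrongDual.toStrongDual_toWeakDual,
      LinearIsometryEquiv.norm_map]
    exact Real.le_sqrt_of_sq_le ((norm_sq_toLp (hD i)).trans_le (hR i))
  obtain ⟨ℓ, -, hℓ⟩ := hc.ultrafilter_le_nhds (l.map T)
    (le_principal_iff.2 (Ultrafilter.mem_map.2 (univ_mem' hmem)))
  obtain ⟨g, hg⟩ := (InnerProductSpace.toDual ℝ (Lp ℝ 2 (volume : Measure ℝ))).surjective
    (WeakDual.toStrongDual ℓ)
  refine ⟨g, Lp.memLp g, fun h hh => ?_⟩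
  have h1 : Tendsto (fun i => T i (hh.toLp h)) l (𝓝 (ℓ (hh.toLp h))) :=
    ((WeakDual.eval_continuous (hh.toLp h)).tendsto ℓ).comp hℓ
  have h2 : ℓ (hh.toLp h) = ∫ x, g x * h x := by
    rw [← inner_toLp_toLp (Lp.memLp g) hh, Lp.toLp_coeFn]
    exact (DFunLike.congr_fun hg (hh.toLp h)).symm
  rw [h2] at h1
  refine h1.congr fun i => ?_
  exact inner_toLp_toLp (hD i) hh

theorem memLp_comp_add_right {h : ℝ → ℝ} (hh : MemLp h 2 volume) (t : ℝ) :
    MemLp (fun x => h (x + t)) 2 volume :=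
  hh.comp_measurePreserving (measurePreserving_add_right volume t)

theorem memLp_translate_sub {h : ℝ → ℝ} (hh : MemLp h 2 volume) (t : ℝ) :
    MemLp (fun x => h (x + t) - h x) 2 volume :=
  (memLp_comp_add_right hh t).sub hh

/-- Translation is continuous in `L²(ℝ)`. -/
theorem tendsto_integral_sq_translate_sub {h : ℝ → ℝ} (hh : MemLp h 2 volume) :
    Tendsto (fun t : ℝ => ∫ x, (h (x + t) - h x) ^ 2) (𝓝 0) (𝓝 0) := by
  have : Fact ((2 : ℝ≥0∞) ≠ ⊤) := ⟨ENNReal.ofNat_ne_top⟩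
  have h1 : Continuous fun t : ℝ => DomAddAct.mk t +ᵥ hh.toLp h :=
    DomAddAct.continuous_mk.vadd continuous_const
  have h2 : Tendsto (fun t : ℝ => ‖(DomAddAct.mk t +ᵥ hh.toLp h) - hh.toLp h‖ ^ 2)
      (𝓝 0) (𝓝 0) := by
    have h3 : Continuous fun t : ℝ => ‖(DomAddAct.mk t +ᵥ hh.toLp h) - hh.toLp h‖ ^ 2 :=
      (h1.sub continuous_const).norm.pow 2
    convert h3.tendsto 0 using 2
    simp
  refine h2.congr fun t => ?_
  have h3 : MemLp (fun x => h (t +ᵥ x)) 2 volume :=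
    hh.comp_measurePreserving (measurePreserving_vadd t volume)
  rw [DomAddAct.mk_vadd_toLp, ← MemLp.toLp_sub, norm_sq_toLp]
  refine integral_congr_ae (Eventually.of_forall fun x => ?_)
  simp [add_comm]

/-- Bounded weakly convergent families, translated by vanishing amounts, have the same weak
limit. -/
theorem tendsto_integral_translate_mul {ι : Type*} {l : Filter ι} {D : ι → ℝ → ℝ} {R : ℝ}
    (hD : ∀ i, MemLp (D i) 2 volume) (hR : ∀ i, ∫ x, D i x ^ 2 ≤ R) {g h : ℝ → ℝ}
    (hh : MemLp h 2 volume)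
    (hlim : Tendsto (fun i => ∫ x, D i x * h x) l (𝓝 (∫ x, g x * h x)))
    {t : ι → ℝ} (ht : Tendsto t l (𝓝 0)) :
    Tendsto (fun i => ∫ x, D i (x + t i) * h x) l (𝓝 (∫ x, g x * h x)) := by
  have h1 : ∀ i, ∫ x, D i (x + t i) * h x
      = (∫ x, D i x * h x) + ∫ x, D i x * (h (x + -t i) - h x) := by
    intro i
    have e : ∫ x, D i (x + t i) * h x = ∫ x, D i x * h (x + -t i) := by
      rw [← integral_add_right_eq_self (fun x => D i x * h (x + -t i)) (t i)]
      simp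
    rw [e, ← integral_add (integrable_mul_of_memLp_two (hD i) hh)
      (integrable_mul_of_memLp_two (hD i) (memLp_translate_sub hh _))]
    congr 1; ext x; ring
  have h2 : Tendsto (fun i => ∫ x, D i x * (h (x + -t i) - h x)) l (𝓝 0) := by
    have h3 : Tendsto (fun i => √(R * ∫ x, (h (x + -t i) - h x) ^ 2)) l (𝓝 0) := by
      have h4 := (tendsto_integral_sq_translate_sub hh).comp (by simpa using ht.neg)
      have h5 := (Real.continuous_sqrt.tendsto _).comp (h4.const_mul R)
      simpa [Function.comp_def] using h5
    refine squeeze_zero_norm (fun i => ?_) h3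
    rw [Real.norm_eq_abs]
    refine Real.abs_le_sqrt ?_
    refine (sq_integral_mul_le (hD i) (memLp_translate_sub hh _)).trans ?_
    exact mul_le_mul_of_nonneg_right (hR i) (integral_sq_nonneg _ _)
  simpa [h1] using hlim.add h2

/-! ### Primitives of square-integrable functions on an interval -/

/-- The primitive of `g` that vanishes at `-∞`. It is meaningful for integrable `g`. -/
def prim (g : ℝ → ℝ) (x : ℝ) : ℝ := ∫ t in Iic x, g t

/-- `g` is square integrable, vanishes outside `(A, B)` up to a null set and has zero mean. These
are the weak derivatives of the functions in `H¹₀(A, B)`. -/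
structure IsGradOn (A B : ℝ) (g : ℝ → ℝ) : Prop where
  memLp : MemLp g 2 volume
  ae_zero : ∀ᵐ x, x ∉ Ioo A B → g x = 0
  mean_zero : ∫ x, g x = 0

theorem integrable_of_memLp_of_ae_zero {A B : ℝ} {g : ℝ → ℝ} (hg : MemLp g 2 volume)
    (h0 : ∀ᵐ x, x ∉ Ioo A B → g x = 0) : Integrable g volume := by
  have h1 : IntegrableOn g (Ioo A B) volume :=
    (hg.restrict _).integrable one_le_two
  refine (integrableOn_iff_integrable_of_support_subset (s := Ioo A B) (f := (Ioo A B).indicator g)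
    (by simp)).1 (h1.congr_fun (fun x hx => by simp [hx]) measurableSet_Ioo) |>.congr ?_
  filter_upwards [h0] with x hx
  by_cases h : x ∈ Ioo A B
  · simp [h]
  · simp [h, hx h]

theorem prim_sub_prim {g : ℝ → ℝ} (hg : Integrable g volume) (x y : ℝ) :
    prim g y - prim g x = ∫ t in x..y, g t :=
  intervalIntegral.integral_Iic_sub_Iic hg.integrableOn hg.integrableOn

theorem continuous_prim {g : ℝ → ℝ} (hg : Integrable g volume) : Continuous (prim g) := by
  have h : prim g = fun y => prim g 0 + ∫ t in (0 : ℝ)..y, g t := by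
    ext y; rw [← prim_sub_prim hg]; ring
  rw [h]
  exact continuous_const.add
    (intervalIntegral.continuous_primitive (fun _ _ => hg.intervalIntegrable) 0)

theorem prim_sub {g h : ℝ → ℝ} (hg : Integrable g volume) (hh : Integrable h volume) (x : ℝ) :
    prim (fun t => g t - h t) x = prim g x - prim h x :=
  integral_sub hg.integrableOn hh.integrableOn

/-- Primitives of square-integrable functions are Hölder continuous with exponent `1/2`. -/
theorem sq_prim_sub_prim_le {g : ℝ → ℝ} (hg : MemLp g 2 volume) (hi : Integrable g volume)
    (x y : ℝ) : (prim g y - prim g x) ^ 2 ≤ |y - x| * ∫ t, g t ^ 2 := by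
  rw [prim_sub_prim hi, ← sq_abs, intervalIntegral.abs_intervalIntegral_eq, sq_abs]
  refine (sq_setIntegral_le measurableSet_uIoc (by simp [uIoc]) hg).trans_eq ?_
  rw [Measure.real, Real.volume_uIoc, ENNReal.toReal_ofReal (abs_nonneg _)]

namespace IsGradOn

variable {A B : ℝ} {g : ℝ → ℝ}

theorem integrable (hg : IsGradOn A B g) : Integrable g volume :=
  integrable_of_memLp_of_ae_zero hg.memLp hg.ae_zero

theorem mono (hg : IsGradOn A B g) {A' B' : ℝ} (hA : A' ≤ A) (hB : B ≤ B') :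
    IsGradOn A' B' g :=
  ⟨hg.memLp, hg.ae_zero.mono fun _ hx h => hx fun h' => h (Ioo_subset_Ioo hA hB h'), hg.mean_zero⟩

theorem sub (hg : IsGradOn A B g) {h : ℝ → ℝ} (hh : IsGradOn A B h) :
    IsGradOn A B (fun x => g x - h x) :=
  ⟨hg.memLp.sub hh.memLp,
    by filter_upwards [hg.ae_zero, hh.ae_zero] with x h1 h2 h3; rw [h1 h3, h2 h3, sub_zero],
    by rw [integral_sub hg.integrable hh.integrable, hg.mean_zero, hh.mean_zero, sub_zero]⟩

theorem prim_eq_zero (hg : IsGradOn A B g) {x : ℝ} (hx : x ∉ Ioo A B) : prim g x = 0 := by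
  rw [mem_Ioo, not_and_or, not_lt, not_lt] at hx
  rcases hx with hx | hx
  · refine integral_eq_zero_of_ae ?_
    filter_upwards [ae_restrict_mem measurableSet_Iic, ae_restrict_of_ae hg.ae_zero] with t h1 h2
    exact h2 fun h3 => (h3.1.trans_le (h1.trans hx)).false
  · have h1 : ∫ t in Ioi x, g t = 0 := by
      refine integral_eq_zero_of_ae ?_
      filter_upwards [ae_restrict_mem measurableSet_Ioi, ae_restrict_of_ae hg.ae_zero] with t h1 h2
      exact h2 fun h3 => (h3.2.trans_le (hx.trans (le_of_lt h1))).false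
    have h2 := intervalIntegral.integral_Iic_add_Ioi (b := x) hg.integrable.integrableOn
      hg.integrable.integrableOn
    rw [h1, hg.mean_zero, add_zero] at h2
    exact h2

theorem sq_prim_le (hg : IsGradOn A B g) (x : ℝ) :
    prim g x ^ 2 ≤ (Ioo A B).indicator (fun _ => (B - A) * ∫ t, g t ^ 2) x := by
  by_cases hx : x ∈ Ioo A B
  · have h1 := sq_prim_sub_prim_le hg.memLp hg.integrable A x
    rw [hg.prim_eq_zero (x := A) (by simp), sub_zero, abs_of_pos (sub_pos.2 hx.1)] at h1
    rw [indicator_of_mem hx]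
    exact h1.trans (mul_le_mul_of_nonneg_right (by linarith [hx.2]) (integral_sq_nonneg _ _))
  · simp [hx, hg.prim_eq_zero hx]

theorem integrable_sq_prim (hg : IsGradOn A B g) :
    Integrable (fun x => prim g x ^ 2) volume := by
  refine Integrable.mono' (g := (Ioo A B).indicator fun _ => (B - A) * ∫ t, g t ^ 2) ?_
    ((continuous_prim hg.integrable).pow 2).aestronglyMeasurable (Eventually.of_forall fun x => ?_)
  · exact (integrable_indicator_iff measurableSet_Ioo).2 (integrableOn_const (by simp))
  · rw [Real.norm_of_nonneg (sq_nonneg _)]; exact hg.sq_prim_le x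

theorem memLp_prim (hg : IsGradOn A B g) : MemLp (prim g) 2 volume :=
  (memLp_two_iff_integrable_sq (continuous_prim hg.integrable).aestronglyMeasurable).2
    hg.integrable_sq_prim

/-- The Poincaré inequality. -/
theorem integral_sq_prim_le (hg : IsGradOn A B g) (hAB : A ≤ B) :
    ∫ x, prim g x ^ 2 ≤ (B - A) ^ 2 * ∫ x, g x ^ 2 := by
  refine (integral_mono hg.integrable_sq_prim
    ((integrable_indicator_iff measurableSet_Ioo).2 (integrableOn_const (by simp)))
    hg.sq_prim_le).trans_eq ?_
  rw [integral_indicator measurableSet_Ioo]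
  simp [hAB]
  ring

/-- Integration by parts: the boundary terms vanish since `prim g` is zero outside `(A, B)`. -/
theorem integral_prim_mul_deriv (hg : IsGradOn A B g) (hAB : A ≤ B) {Φ : ℝ → ℝ}
    (hΦ : ContDiff ℝ 1 Φ) : ∫ x, prim g x * deriv Φ x = - ∫ x, g x * Φ x := by
  have e1 : ∫ x, prim g x * deriv Φ x = ∫ x in A..B, prim g x * deriv Φ x := by
    rw [intervalIntegral.integral_of_le hAB, setIntegral_eq_integral_of_forall_compl_eq_zero]
    intro x hx
    rw [hg.prim_eq_zero fun h => hx (Ioo_subset_Ioc_self h), zero_mul]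
  have e2 : ∫ x, g x * Φ x = ∫ x in A..B, g x * Φ x := by
    rw [intervalIntegral.integral_of_le hAB, setIntegral_eq_integral_of_ae_compl_eq_zero]
    filter_upwards [hg.ae_zero] with x hx h
    rw [hx fun h' => h (Ioo_subset_Ioc_self h'), zero_mul]
  have hI : IntervalIntegrable g volume A B := hg.integrable.intervalIntegrable
  have h1 : AbsolutelyContinuousOnInterval (fun x => ∫ t in A..x, g t) A B :=
    hI.absolutelyContinuousOnInterval_intervalIntegral (by simp)
  have h2 : AbsolutelyContinuousOnInterval Φ A B := hΦ.contDiffOn.absolutelyContinuousOnInterval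
  have e3 : prim g = fun x => ∫ t in A..x, g t := by
    ext x; rw [← prim_sub_prim hg.integrable, hg.prim_eq_zero (x := A) (by simp), sub_zero]
  rw [← e3] at h1
  have h3 := h1.integral_mul_deriv_eq_deriv_mul h2
  rw [hg.prim_eq_zero (x := A) (by simp), hg.prim_eq_zero (x := B) (by simp)] at h3
  rw [e1, e2, h3]
  simp only [zero_mul, sub_self, zero_sub, neg_inj]
  refine intervalIntegral.integral_congr_ae ?_
  filter_upwards [hI.ae_hasDerivAt_integral] with x hx hxm
  rw [e3, (hx (uIoc_subset_uIcc hxm) A (by simp)).deriv]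

theorem isWeakDeriv (hg : IsGradOn A B g) (hAB : A ≤ B) : IsWeakDeriv (prim g) g :=
  ⟨(continuous_prim hg.integrable).locallyIntegrable, hg.integrable.locallyIntegrable,
    fun _ hφ _ => hg.integral_prim_mul_deriv hAB (hφ.of_le (by norm_cast))⟩

end IsGradOn

theorem IsWeakDeriv.ae_eq {u g h : ℝ → ℝ} (hg : IsWeakDeriv u g) (hh : IsWeakDeriv u h) :
    g =ᵐ[volume] h := by
  refine ae_eq_of_integral_contDiff_smul_eq hg.2.1 hh.2.1 fun φ h1 h2 => ?_
  have := (hg.2.2 φ h1 h2).symm.trans (hh.2.2 φ h1 h2)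
  simpa [mul_comm] using this

theorem IsWeakDeriv.weakDeriv_ae_eq {u g : ℝ → ℝ} (hg : IsWeakDeriv u g)
    (hm : MemLp g 2 volume) : weakDeriv u =ᵐ[volume] g := by
  have h : ∃ g : ℝ → ℝ, MemLp g 2 volume ∧ IsWeakDeriv u g := ⟨g, hm, hg⟩
  unfold weakDeriv
  rw [dif_pos h]
  exact h.choose_spec.2.ae_eq hg

/-! ### The space `H¹₀(a, b)` -/

theorem tendsto_eLpNorm_two_iff {f : ℕ → ℝ → ℝ} (hf : ∀ n, MemLp (f n) 2 volume) :
    Tendsto (fun n => eLpNorm (f n) 2 volume) atTop (𝓝 0) ↔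
      Tendsto (fun n => ∫ x, f n x ^ 2) atTop (𝓝 0) := by
  simp only [fun n => eLpNorm_two_eq (hf n)]
  constructor
  · intro h
    have h1 := (ENNReal.tendsto_toReal (by simp)).comp h
    have h2 := h1.pow 2
    simp only [Function.comp_def, ENNReal.toReal_ofReal (Real.sqrt_nonneg _),
      Real.sq_sqrt (integral_sq_nonneg _ _)] at h2
    simpa using h2
  · intro h
    have h1 := ENNReal.tendsto_ofReal ((Real.continuous_sqrt.tendsto _).comp h)
    simpa using h1

/-- A test function supported in `(a, b)` is the primitive of its derivative. -/
theorem isGradOn_deriv_and_prim_deriv {a b : ℝ} {φ : ℝ → ℝ} (h1 : ContDiff ℝ ∞ φ)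
    (h2 : HasCompactSupport φ) (h3 : tsupport φ ⊆ Ioo a b) :
    IsGradOn a b (deriv φ) ∧ prim (deriv φ) = φ := by
  have hc : Continuous (deriv φ) := h1.continuous_deriv (by norm_cast)
  have hz : ∀ x, x ∉ Ioo a b → deriv φ x = 0 := fun x hx =>
    image_eq_zero_of_notMem_tsupport fun h => hx (h3 (tsupport_deriv_subset h))
  have hi : Integrable (deriv φ) volume := hc.integrable_of_hasCompactSupport h2.deriv
  have hp : prim (deriv φ) = φ := by
    ext x
    exact HasCompactSupport.integral_Iic_deriv_eq (h1.of_le (by norm_cast)) h2 x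
  refine ⟨⟨hc.memLp_of_hasCompactSupport h2.deriv, Eventually.of_forall hz, ?_⟩, hp⟩
  have h := intervalIntegral.integral_Iic_add_Ioi (b := max a b) hi.integrableOn hi.integrableOn
  rw [← h]
  have e1 : ∫ t in Iic (max a b), deriv φ t = 0 := by
    change prim (deriv φ) (max a b) = 0
    rw [hp]
    exact image_eq_zero_of_notMem_tsupport fun h =>
      ((le_max_right a b).trans_lt (h3 h).2).false
  have e2 : ∫ t in Ioi (max a b), deriv φ t = 0 := by
    rw [setIntegral_congr_fun measurableSet_Ioi (g := fun _ => (0 : ℝ))]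
    · simp
    · intro x hx
      exact hz x fun h => ((le_max_right a b).trans_lt hx |>.trans h.2).false
  rw [e1, e2, add_zero]

theorem MemH10.exists_isGradOn {a b : ℝ} (hab : a < b) {w : ℝ → ℝ} (hw : MemH10 a b w) :
    ∃ g, IsGradOn a b g ∧ w =ᵐ[volume] prim g ∧ weakDeriv w =ᵐ[volume] g := by
  obtain ⟨hwm, g, hg, hwg, φ, hφ, hφw, hφg⟩ := hw
  have hG : ∀ n, IsGradOn a b (deriv (φ n)) := fun n =>
    (isGradOn_deriv_and_prim_deriv (hφ n).1 (hφ n).2.1 (hφ n).2.2).1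
  have hP : ∀ n, prim (deriv (φ n)) = φ n := fun n =>
    (isGradOn_deriv_and_prim_deriv (hφ n).1 (hφ n).2.1 (hφ n).2.2).2
  have hm : ∀ n, MemLp (fun x => deriv (φ n) x - g x) 2 volume := fun n => (hG n).memLp.sub hg
  have hφg' : Tendsto (fun n => ∫ x, (deriv (φ n) x - g x) ^ 2) atTop (𝓝 0) :=
    (tendsto_eLpNorm_two_iff hm).1 hφg
  have h0 : ∀ᵐ x, x ∉ Ioo a b → g x = 0 := by
    have h1 : ∫ x in (Ioo a b)ᶜ, g x ^ 2 ≤ 0 := by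
      refine ge_of_tendsto' hφg' fun n => ?_
      have h2 : ∫ x in (Ioo a b)ᶜ, g x ^ 2 = ∫ x in (Ioo a b)ᶜ, (deriv (φ n) x - g x) ^ 2 := by
        refine setIntegral_congr_ae measurableSet_Ioo.compl ?_
        filter_upwards [(hG n).ae_zero] with x hx h
        rw [hx h]; ring
      rw [h2]
      exact setIntegral_le_integral (hm n).integrable_sq
        (Eventually.of_forall fun x => sq_nonneg _)
    have h2 : ∫ x in (Ioo a b)ᶜ, g x ^ 2 = 0 :=
      le_antisymm h1 (integral_sq_nonneg _ _)
    rw [setIntegral_eq_zero_iff_of_nonneg_ae (Eventually.of_forall fun x => sq_nonneg _)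
      hg.integrable_sq.integrableOn, EventuallyEq, ae_restrict_iff' measurableSet_Ioo.compl] at h2
    filter_upwards [h2] with x hx h
    simpa using hx h
  have hgi := integrable_of_memLp_of_ae_zero hg h0
  have hmean : ∫ x, g x = 0 := by
    have h1 : ∀ n, (∫ x, g x) ^ 2 ≤ (b - a) * ∫ x, (deriv (φ n) x - g x) ^ 2 := by
      intro n
      have h2 := sq_setIntegral_le (s := Ioo a b) measurableSet_Ioo (by simp) (hm n)
      have h3 : ∫ x in Ioo a b, (deriv (φ n) x - g x) = - ∫ x, g x := by
        rw [setIntegral_eq_integral_of_ae_compl_eq_zero, integral_sub (hG n).integrable hgi,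
          (hG n).mean_zero, zero_sub]
        filter_upwards [(hG n).ae_zero, h0] with x h4 h5 h6
        rw [h4 h6, h5 h6, sub_zero]
      rw [h3, neg_sq, Real.volume_real_Ioo_of_le hab.le] at h2
      exact h2
    have h2 := ge_of_tendsto' (hφg'.const_mul (b - a)) h1
    rw [mul_zero] at h2
    exact pow_eq_zero_iff two_ne_zero |>.1 (le_antisymm h2 (sq_nonneg _))
  have hgrad : IsGradOn a b g := ⟨hg, h0, hmean⟩
  have hφp : Tendsto (fun n => eLpNorm (φ n - prim g) 2 volume) atTop (𝓝 0) := by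
    have hs : ∀ n, φ n - prim g = prim fun x => deriv (φ n) x - g x := by
      intro n; ext x
      rw [prim_sub (hG n).integrable hgi, hP n]; rfl
    refine (tendsto_eLpNorm_two_iff fun n => ?_).2 ?_
    · rw [hs]; exact ((hG n).sub hgrad).memLp_prim
    · refine squeeze_zero (fun n => integral_sq_nonneg _ _) (fun n => ?_)
        (by simpa using hφg'.const_mul ((b - a) ^ 2))
      rw [hs]
      exact ((hG n).sub hgrad).integral_sq_prim_le hab.le
  refine ⟨g, hgrad, ?_, hwg.weakDeriv_ae_eq hg⟩
  have hφm : ∀ n, AEStronglyMeasurable (φ n) volume := fun n =>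
    (hφ n).1.continuous.aestronglyMeasurable
  have h1 : Tendsto (fun n => eLpNorm (φ n - w) 2 volume + eLpNorm (φ n - prim g) 2 volume)
      atTop (𝓝 0) := by simpa using hφw.add hφp
  have h2 : eLpNorm (w - prim g) 2 volume ≤ 0 := by
    refine ge_of_tendsto' h1 fun n => ?_
    have h3 : w - prim g = (φ n - prim g) - (φ n - w) := by abel
    rw [h3, add_comm]
    exact eLpNorm_sub_le ((hφm n).sub hgrad.memLp_prim.1) ((hφm n).sub hwm.1) one_le_two
  have h3 := (eLpNorm_eq_zero_iff (hwm.1.sub hgrad.memLp_prim.1) two_ne_zero).1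
    (le_antisymm h2 zero_le)
  filter_upwards [h3] with x hx
  exact sub_eq_zero.1 hx

/-- Test functions supported in `(a, b)` are dense in the square-integrable functions vanishing
outside `(a, b)`: nothing but zero is orthogonal to them. -/
theorem exists_testFunctions_tendsto {a b : ℝ} {g : ℝ → ℝ} (hg : MemLp g 2 volume)
    (h0 : ∀ᵐ x, x ∉ Ioo a b → g x = 0) :
    ∃ ψ : ℕ → ℝ → ℝ, (∀ n, ContDiff ℝ ∞ (ψ n) ∧ HasCompactSupport (ψ n) ∧
      tsupport (ψ n) ⊆ Ioo a b) ∧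
      Tendsto (fun n => ∫ x, (ψ n x - g x) ^ 2) atTop (𝓝 0) := by
  let V : Submodule ℝ (Lp ℝ 2 (volume : Measure ℝ)) :=
    { carrier := {v | ∃ ψ : ℝ → ℝ, ContDiff ℝ ∞ ψ ∧ HasCompactSupport ψ ∧
        tsupport ψ ⊆ Ioo a b ∧ v =ᵐ[volume] ψ}
      zero_mem' := ⟨0, contDiff_const, HasCompactSupport.zero, by simp [tsupport],
        Lp.coeFn_zero _ _ _⟩
      add_mem' := by
        rintro v w ⟨ψ, h1, h2, h3, h4⟩ ⟨χ, k1, k2, k3, k4⟩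
        exact ⟨ψ + χ, h1.add k1, h2.add k2, (tsupport_add ψ χ).trans (union_subset h3 k3),
          (Lp.coeFn_add v w).trans (h4.add k4)⟩
      smul_mem' := by
        rintro c v ⟨ψ, h1, h2, h3, h4⟩
        exact ⟨c • ψ, h1.const_smul c, h2.smul_left (f := fun _ => c),
          (tsupport_smul_subset_right (fun _ => c) ψ).trans h3,
          (Lp.coeFn_smul c v).trans (h4.const_smul c)⟩ }
  have hmem : hg.toLp g ∈ V.topologicalClosure := by
    rw [← Submodule.orthogonal_orthogonal_eq_closure, Submodule.mem_orthogonal]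
    intro h hh
    rw [Submodule.mem_orthogonal] at hh
    have h1 : ∀ᵐ x, x ∈ Ioo a b → h x = 0 := by
      refine isOpen_Ioo.ae_eq_zero_of_integral_contDiff_smul_eq_zero
        ((Lp.memLp h).locallyIntegrable one_le_two |>.locallyIntegrableOn _) ?_
      intro ψ k1 k2 k3
      have hψ : MemLp ψ 2 volume := k1.continuous.memLp_of_hasCompactSupport k2
      have := hh (hψ.toLp ψ) ⟨ψ, k1, k2, k3, hψ.coeFn_toLp⟩
      rw [← Lp.toLp_coeFn h (Lp.memLp h), inner_toLp_toLp] at this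
      exact this
    rw [← Lp.toLp_coeFn h (Lp.memLp h), inner_toLp_toLp]
    refine integral_eq_zero_of_ae ?_
    filter_upwards [h1, h0] with x k1 k2
    by_cases hx : x ∈ Ioo a b
    · simp [k1 hx]
    · simp [k2 hx]
  obtain ⟨v, hv, hlim⟩ := mem_closure_iff_seq_limit.1 hmem
  choose ψ h1 h2 h3 h4 using hv
  refine ⟨ψ, fun n => ⟨h1 n, h2 n, h3 n⟩, ?_⟩
  have h5 := (tendsto_iff_norm_sub_tendsto_zero.1 hlim).pow 2
  rw [zero_pow two_ne_zero] at h5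
  refine h5.congr fun n => ?_
  have hψ : MemLp (ψ n) 2 volume := (h1 n).continuous.memLp_of_hasCompactSupport (h2 n)
  have e : v n = hψ.toLp (ψ n) := Lp.ext ((h4 n).trans hψ.coeFn_toLp.symm)
  rw [e, ← MemLp.toLp_sub, norm_sq_toLp]
  rfl

/-- A test function on `(a, b)` with zero mean is the derivative of a test function on `(a, b)`. -/
theorem prim_testFunction {a b : ℝ} {ψ : ℝ → ℝ} (h1 : ContDiff ℝ ∞ ψ)
    (h2 : HasCompactSupport ψ) (h3 : tsupport ψ ⊆ Ioo a b) (h4 : ∫ x, ψ x = 0) :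
    ContDiff ℝ ∞ (prim ψ) ∧ HasCompactSupport (prim ψ) ∧ tsupport (prim ψ) ⊆ Ioo a b ∧
      deriv (prim ψ) = ψ := by
  have hi : Integrable ψ volume := h1.continuous.integrable_of_hasCompactSupport h2
  have hd : ∀ x, HasDerivAt (prim ψ) (ψ x) x := by
    intro x
    have e : prim ψ = fun y => prim ψ 0 + ∫ t in (0 : ℝ)..y, ψ t := by
      ext y; rw [← prim_sub_prim hi]; ring
    rw [e]
    exact (intervalIntegral.integral_hasDerivAt_right hi.intervalIntegrable
      (h1.continuous.stronglyMeasurableAtFilter _ _) h1.continuous.continuousAt).const_add _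
  have hderiv : deriv (prim ψ) = ψ := funext fun x => (hd x).deriv
  obtain ⟨c, d, hcd, hsub⟩ : ∃ c d, tsupport ψ ⊆ Ioo c d ∧ Icc c d ⊆ Ioo a b := by
    rcases (tsupport ψ).eq_empty_or_nonempty with he | hne
    · exact ⟨1, 0, by simp [he], by simp⟩
    · have hK : IsCompact (tsupport ψ) := h2
      have hm := h3 (hK.sInf_mem hne)
      have hM := h3 (hK.sSup_mem hne)
      obtain ⟨c, hc1, hc2⟩ := exists_between hm.1
      obtain ⟨d, hd1, hd2⟩ := exists_between hM.2
      exact ⟨c, d, fun x hx => ⟨hc2.trans_le (csInf_le hK.bddBelow hx),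
        (le_csSup hK.bddAbove hx).trans_lt hd1⟩, Icc_subset_Ioo hc1 hd2⟩
  have hG : IsGradOn c d ψ := ⟨h1.continuous.memLp_of_hasCompactSupport h2,
    Eventually.of_forall fun x hx => image_eq_zero_of_notMem_tsupport fun h => hx (hcd h), h4⟩
  have hsupp : tsupport (prim ψ) ⊆ Icc c d := by
    refine closure_minimal (fun x hx => ?_) isClosed_Icc
    by_contra h
    exact hx (hG.prim_eq_zero fun h' => h (Ioo_subset_Icc_self h'))
  refine ⟨?_, HasCompactSupport.intro isCompact_Icc fun x hx =>
    image_eq_zero_of_notMem_tsupport fun h => hx (hsupp h), hsupp.trans hsub, hderiv⟩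
  rw [contDiff_infty_iff_deriv]
  exact ⟨fun x => (hd x).differentiableAt, by rwa [hderiv]⟩

theorem IsGradOn.memH10 {a b : ℝ} (hab : a < b) {g w : ℝ → ℝ} (hg : IsGradOn a b g)
    (hw : w =ᵐ[volume] prim g) : MemH10 a b w := by
  obtain ⟨ψ, hψ, hlim⟩ := exists_testFunctions_tendsto hg.memLp hg.ae_zero
  -- a test function with unit mean, used to correct the means of the `ψ n`
  obtain ⟨η, η1, η2, η3, η4⟩ : ∃ η : ℝ → ℝ, ContDiff ℝ ∞ η ∧ HasCompactSupport η ∧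
      tsupport η ⊆ Ioo a b ∧ ∫ x, η x = 1 := by
    let B : ContDiffBump ((a + b) / 2) := ⟨(b - a) / 8, (b - a) / 4, by linarith, by linarith⟩
    refine ⟨B.normed volume, B.contDiff_normed, B.hasCompactSupport_normed, ?_,
      B.integral_normed⟩
    rw [B.tsupport_normed_eq, Real.closedBall_eq_Icc]
    intro x hx
    change x ∈ Icc ((a + b) / 2 - (b - a) / 4) ((a + b) / 2 + (b - a) / 4) at hx
    constructor <;> linarith [hx.1, hx.2]
  have hψi : ∀ n, Integrable (ψ n) volume := fun n =>
    (hψ n).1.continuous.integrable_of_hasCompactSupport (hψ n).2.1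
  have hψm : ∀ n, MemLp (ψ n) 2 volume := fun n =>
    (hψ n).1.continuous.memLp_of_hasCompactSupport (hψ n).2.1
  have hηi : Integrable η volume := η1.continuous.integrable_of_hasCompactSupport η2
  have hηm : MemLp η 2 volume := η1.continuous.memLp_of_hasCompactSupport η2
  set m : ℕ → ℝ := fun n => ∫ x, ψ n x
  set χ : ℕ → ℝ → ℝ := fun n x => ψ n x - m n * η x with hχ
  have c1 : ∀ n, ContDiff ℝ ∞ (χ n) := fun n => (hψ n).1.sub (contDiff_const.mul η1)
  have hsub : ∀ n, tsupport (χ n) ⊆ tsupport (ψ n) ∪ tsupport η := by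
    intro n
    refine closure_minimal (fun x hx => ?_) ((isClosed_tsupport _).union (isClosed_tsupport _))
    by_contra h
    rw [mem_union, not_or] at h
    exact hx (by simp [hχ, image_eq_zero_of_notMem_tsupport h.1,
      image_eq_zero_of_notMem_tsupport h.2])
  have c2 : ∀ n, HasCompactSupport (χ n) := fun n =>
    ((hψ n).2.1.isCompact.union η2.isCompact).of_isClosed_subset (isClosed_tsupport _) (hsub n)
  have c3 : ∀ n, tsupport (χ n) ⊆ Ioo a b := fun n =>
    (hsub n).trans (union_subset (hψ n).2.2 η3)
  have c4 : ∀ n, ∫ x, χ n x = 0 := by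
    intro n
    simp only [hχ]
    rw [integral_sub (hψi n) (hηi.const_mul _), integral_const_mul, η4, mul_one, sub_self]
  have hcm : ∀ n, MemLp (fun x => χ n x - g x) 2 volume := fun n =>
    ((hψm n).sub (hηm.const_mul (m n))).sub hg.memLp
  have hm0 : Tendsto (fun n => m n ^ 2) atTop (𝓝 0) := by
    refine squeeze_zero (fun n => sq_nonneg _) (fun n => ?_)
      (by simpa using hlim.const_mul (b - a))
    have h2 := sq_setIntegral_le (s := Ioo a b) measurableSet_Ioo (by simp)
      ((hψm n).sub hg.memLp)
    have h3 : ∫ x in Ioo a b, (ψ n - g) x = m n := by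
      rw [setIntegral_eq_integral_of_ae_compl_eq_zero]
      · simp only [Pi.sub_apply]
        rw [integral_sub (hψi n) hg.integrable, hg.mean_zero, sub_zero]
      · filter_upwards [hg.ae_zero] with x h5 h6
        rw [Pi.sub_apply, h5 h6, sub_zero,
          image_eq_zero_of_notMem_tsupport fun h => h6 ((hψ n).2.2 h)]
    rw [h3, Real.volume_real_Ioo_of_le hab.le] at h2
    exact h2
  have hχg : Tendsto (fun n => ∫ x, (χ n x - g x) ^ 2) atTop (𝓝 0) := by
    refine squeeze_zero (fun n => integral_sq_nonneg _ _)
      (g := fun n => 2 * (∫ x, (ψ n x - g x) ^ 2) + 2 * (m n ^ 2 * ∫ x, η x ^ 2)) (fun n => ?_)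
      (by simpa using (hlim.const_mul 2).add ((hm0.mul_const (∫ x, η x ^ 2)).const_mul 2))
    have i1 : Integrable (fun x => 2 * (ψ n x - g x) ^ 2) volume :=
      (((hψm n).sub hg.memLp).integrable_sq).const_mul 2
    have i2 : Integrable (fun x => 2 * (m n ^ 2 * η x ^ 2)) volume :=
      (hηm.integrable_sq.const_mul _).const_mul 2
    rw [← integral_const_mul, ← integral_const_mul, ← integral_const_mul, ← integral_add i1 i2]
    refine integral_mono (hcm n).integrable_sq (i1.add i2) fun x => ?_
    simp only [hχ]
    nlinarith [sq_nonneg (ψ n x - g x + m n * η x)]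
  have hT := fun n => prim_testFunction (c1 n) (c2 n) (c3 n) (c4 n)
  have hGχ : ∀ n, IsGradOn a b (χ n) := fun n =>
    ⟨(hψm n).sub (hηm.const_mul (m n)), Eventually.of_forall fun x hx =>
      image_eq_zero_of_notMem_tsupport fun h => hx (c3 n h), c4 n⟩
  refine ⟨hg.memLp_prim.ae_eq hw.symm, g, hg.memLp, ?_, fun n => prim (χ n),
    fun n => ⟨(hT n).1, (hT n).2.1, (hT n).2.2.1⟩, ?_, ?_⟩
  · obtain ⟨-, k2, k3⟩ := hg.isWeakDeriv hab.le
    refine ⟨(hg.memLp_prim.ae_eq hw.symm).locallyIntegrable one_le_two, k2, fun φ h1 h2 => ?_⟩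
    rw [← k3 φ h1 h2]
    refine integral_congr_ae ?_
    filter_upwards [hw] with x hx
    rw [hx]
  · have e : ∀ n, eLpNorm (prim (χ n) - w) 2 volume
        = eLpNorm (prim fun x => χ n x - g x) 2 volume := by
      intro n
      refine eLpNorm_congr_ae ?_
      filter_upwards [hw] with x hx
      rw [Pi.sub_apply, hx, prim_sub (hGχ n).integrable hg.integrable]
    simp only [e]
    rw [tendsto_eLpNorm_two_iff fun n => ((hGχ n).sub hg).memLp_prim]
    refine squeeze_zero (fun n => integral_sq_nonneg _ _)
      (fun n => ((hGχ n).sub hg).integral_sq_prim_le hab.le)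
      (by simpa using hχg.const_mul ((b - a) ^ 2))
  · have e : ∀ n, deriv (prim (χ n)) - g = fun x => χ n x - g x := by
      intro n; rw [(hT n).2.2.2]; rfl
    simp only [e]
    exact (tendsto_eLpNorm_two_iff hcm).2 hχg

/-! ### Lattice functions of finite support -/

/-- The forward difference quotient at scale `ε`. -/
def diffQuot (ε : ℝ) (u : ℤ → ℝ) (k : ℤ) : ℝ := (u (k + 1) - u k) / ε

theorem summable_of_finite {p : ℤ → ℝ} (hp : (Function.support p).Finite) : Summable p :=
  summable_of_hasFiniteSupport hp

theorem finite_support_shift {p : ℤ → ℝ} (hp : (Function.support p).Finite) (m : ℤ) :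
    (Function.support fun k => p (k + m)).Finite :=
  (hp.preimage (add_left_injective m).injOn : _)

theorem finite_support_sub {p q : ℤ → ℝ} (hp : (Function.support p).Finite)
    (hq : (Function.support q).Finite) : (Function.support fun k => p k - q k).Finite :=
  (hp.union hq).subset (Function.support_sub p q)

theorem finite_support_shift_sub {p : ℤ → ℝ} (hp : (Function.support p).Finite) (m n : ℤ) :
    (Function.support fun k => p (k + m) - p (k + n)).Finite :=
  finite_support_sub (finite_support_shift hp m) (finite_support_shift hp n)

theorem finite_support_mul {p : ℤ → ℝ} (hp : (Function.support p).Finite) (q : ℤ → ℝ) :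
    (Function.support fun k => p k * q k).Finite :=
  hp.subset (Function.support_mul_subset_left p q)

theorem finite_support_comp {p : ℤ → ℝ} (hp : (Function.support p).Finite) {F : ℝ → ℝ}
    (hF : F 0 = 0) : (Function.support fun k => F (p k)).Finite :=
  hp.subset fun k hk h => hk (by simp only [h, hF])

theorem tsum_shift (p : ℤ → ℝ) (m : ℤ) : ∑' k, p (k + m) = ∑' k, p k :=
  (Equiv.addRight m).tsum_eq p

theorem finite_support_diffQuot {u : ℤ → ℝ} (hu : (Function.support u).Finite) (ε : ℝ) :
    (Function.support (diffQuot ε u)).Finite := by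
  have h := finite_support_shift_sub hu 1 0
  simp only [add_zero] at h
  exact finite_support_comp (F := fun x => x / ε) h (zero_div _)

theorem grad_eq (M : ℕ) (ρ : ℕ → ℝ) (ε : ℝ) (u : ℤ → ℝ) (k : ℤ) :
    grad M ρ ε u k
      = (1 / ε) * ∑ j ∈ Finset.range M, ρ (j + 1) * (u (k + (j + 1)) - u (k + (-j))) := by
  unfold grad
  rw [← Finset.sum_sub_distrib, ← Finset.Ico_add_one_right_eq_Icc, Finset.sum_Ico_eq_sum_range]
  simp only [Nat.add_sub_cancel]
  congr 1
  refine Finset.sum_congr rfl fun j _ => ?_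
  rw [add_comm 1 j, show k - ((j + 1 : ℕ) : ℤ) + 1 = k + (-j) by push_cast; ring]
  push_cast
  ring

theorem finite_support_grad {u : ℤ → ℝ} (hu : (Function.support u).Finite) (M : ℕ) (ρ : ℕ → ℝ)
    (ε : ℝ) : (Function.support (grad M ρ ε u)).Finite := by
  refine (Set.Finite.biUnion (Finset.range M).finite_toSet fun (j : ℕ) _ =>
    finite_support_shift_sub hu ((j : ℤ) + 1) (-j)).subset fun k hk => ?_
  by_contra h
  simp only [mem_iUnion, not_exists, Function.mem_support, not_not] at h
  refine hk ?_
  rw [grad_eq, Finset.sum_eq_zero, mul_zero]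
  intro j hj
  rw [h j hj, mul_zero]

/-! ### Coercivity of the nonlocal gradient -/

/-- Pairing the forward difference with the symmetric sum of `m` nonlocal differences gives a sum
of squares: up to scaling, the symmetric sum is the convolution of the forward difference with
`𝟙_{[0, m)} ⋆ 𝟙_{(-m, 0]}`, a positive definite kernel. -/
theorem tsum_diff_mul_sum_eq {u : ℤ → ℝ} (hu : (Function.support u).Finite) (m : ℕ) :
    ∑' k, (u (k + 1) - u k) * ∑ p ∈ Finset.range m, (u (k + (p + 1)) - u (k + (-p)))
      = ∑' k, (u (k + m) - u k) ^ 2 := by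
  have h0 : ∀ q : ℤ, (Function.support fun k => u (k + q) - u k).Finite := fun q => by
    simpa using finite_support_shift_sub hu q 0
  have h1 : ∀ k : ℤ, (u (k + m) - u k) ^ 2
      = ∑ p ∈ Finset.range m, (u (k + m) - u k) * (u (k + (p + 1)) - u (k + p)) := by
    intro k
    rw [← Finset.mul_sum, sq]
    congr 1
    have := Finset.sum_range_sub (fun p : ℕ => u (k + p)) m
    push_cast at this
    rw [this]; simp
  have h2 : ∀ k : ℤ, (u (k + 1) - u k) * ∑ p ∈ Finset.range m, (u (k + (p + 1)) - u (k + (-p)))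
      = ∑ p ∈ Finset.range m, (u (k + 1) - u k) * (u (k + (-p) + m) - u (k + (-p))) := by
    intro k
    rw [← Finset.mul_sum, Finset.sum_sub_distrib, Finset.sum_sub_distrib]
    congr 2
    rw [← Finset.sum_range_reflect]
    refine Finset.sum_congr rfl fun p hp => ?_
    have := Finset.mem_range.1 hp
    congr 1
    rw [show ((m - 1 - p : ℕ) : ℤ) = m - 1 - p by omega]
    ring
  simp only [h1, h2]
  rw [Summable.tsum_finsetSum fun p _ => summable_of_finite (finite_support_mul (h0 m) _),
    Summable.tsum_finsetSum fun p _ => summable_of_finite (finite_support_mul (h0 1) _)]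
  refine Finset.sum_congr rfl fun p _ => ?_
  rw [← tsum_shift _ (p : ℤ)]
  refine tsum_congr fun k => ?_
  rw [show k + (p : ℤ) + -p = k by ring, show k + (p : ℤ) + 1 = k + (p + 1) by ring, mul_comm]

/-- Summation by parts. -/
theorem sum_mul_eq_sum_sub_mul (r x : ℕ → ℝ) (N : ℕ) :
    ∑ j ∈ Finset.range (N + 1), r j * x j
      = ∑ m ∈ Finset.range N, (r m - r (m + 1)) * ∑ j ∈ Finset.range (m + 1), x j
        + r N * ∑ j ∈ Finset.range (N + 1), x j := by
  induction N with
  | zero => simp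
  | succ N ih =>
    rw [Finset.sum_range_succ, ih, Finset.sum_range_succ x (N + 1),
      Finset.sum_range_succ (fun m => (r m - r (m + 1)) * ∑ j ∈ Finset.range (m + 1), x j) N]
    ring

/-- The coercivity estimate. As `ρ` is positive and strictly decreasing, the nonlocal gradient is a
positive combination of the symmetric sums of `tsum_diff_mul_sum_eq`, among which is the forward
difference itself. -/
theorem exists_coercive {M : ℕ} (hM : 1 ≤ M) {ρ : ℕ → ℝ}
    (hρ_pos : ∀ i ∈ Set.Icc 1 M, 0 < ρ i) (hρ_anti : StrictAntiOn ρ (Set.Icc 1 M)) :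
    ∃ c : ℝ, 0 < c ∧ ∀ (ε : ℝ) (u : ℤ → ℝ), 0 < ε → (Function.support u).Finite →
      c * ∑' k, diffQuot ε u k ^ 2 ≤ ∑' k, grad M ρ ε u k ^ 2 := by
  obtain ⟨N, rfl⟩ : ∃ N, M = N + 1 := ⟨M - 1, by omega⟩
  have hanti : ∀ m < N, 0 < ρ (m + 1) - ρ (m + 1 + 1) := fun m hm =>
    sub_pos.2 (hρ_anti ⟨by omega, by omega⟩ ⟨by omega, by omega⟩ (by omega))
  have hpos : 0 < ρ (N + 1) := hρ_pos _ ⟨by omega, le_rfl⟩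
  obtain ⟨d, hd, hdQ⟩ : ∃ d : ℝ, 0 < d ∧ ∀ Q : ℕ → ℝ, (∀ m, 0 ≤ Q m) →
      d * Q 1 ≤ ∑ m ∈ Finset.range N, (ρ (m + 1) - ρ (m + 1 + 1)) * Q (m + 1)
        + ρ (N + 1) * Q (N + 1) := by
    rcases Nat.eq_zero_or_pos N with rfl | hN
    · exact ⟨ρ 1, hpos, fun Q _ => by simp⟩
    · refine ⟨ρ 1 - ρ 2, hanti 0 hN, fun Q hQ => ?_⟩
      have h1 := Finset.single_le_sum (s := Finset.range N)
        (f := fun m => (ρ (m + 1) - ρ (m + 1 + 1)) * Q (m + 1))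
        (fun m hm => mul_nonneg (hanti m (Finset.mem_range.1 hm)).le (hQ _))
        (Finset.mem_range.2 hN)
      have h2 := mul_nonneg hpos.le (hQ (N + 1))
      simp only [zero_add] at h1
      norm_num at h1
      linarith
  refine ⟨d ^ 2, by positivity, fun ε u hε hu => ?_⟩
  have hD := finite_support_diffQuot hu ε
  have hG := finite_support_grad hu (N + 1) ρ ε
  have hDiff : (Function.support fun k => u (k + 1) - u k).Finite := by
    simpa using finite_support_shift_sub hu 1 0
  have key : d * ∑' k, diffQuot ε u k ^ 2 ≤ ∑' k, diffQuot ε u k * grad (N + 1) ρ ε u k := by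
    have h1 : ∀ k, diffQuot ε u k * grad (N + 1) ρ ε u k = (1 / ε ^ 2) *
        (∑ m ∈ Finset.range N, (ρ (m + 1) - ρ (m + 1 + 1)) * ((u (k + 1) - u k) *
          ∑ p ∈ Finset.range (m + 1), (u (k + (p + 1)) - u (k + (-p))))
        + ρ (N + 1) * ((u (k + 1) - u k) *
          ∑ p ∈ Finset.range (N + 1), (u (k + (p + 1)) - u (k + (-p))))) := by
      intro k
      rw [grad_eq, sum_mul_eq_sum_sub_mul (fun j => ρ (j + 1)), diffQuot]
      simp only [mul_left_comm _ (u (k + 1) - u k), ← Finset.mul_sum]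
      field_simp
    have h2 : ∀ m : ℕ, Summable fun k : ℤ => (u (k + 1) - u k) *
        ∑ p ∈ Finset.range m, (u (k + (p + 1)) - u (k + (-p))) := fun m =>
      summable_of_finite (finite_support_mul hDiff _)
    have h3 := hdQ (fun m => ∑' k, (u (k + m) - u k) ^ 2) fun m =>
      tsum_nonneg fun k : ℤ => sq_nonneg (u (k + m) - u k)
    simp only [h1]
    have h5 : ∀ m : ℕ, Summable fun k : ℤ => (ρ (m + 1) - ρ (m + 1 + 1)) * ((u (k + 1) - u k) *
        ∑ p ∈ Finset.range (m + 1), (u (k + (p + 1)) - u (k + (-p)))) := fun m =>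
      (h2 (m + 1)).mul_left _
    have h6 := summable_sum (s := Finset.range N) fun m _ => h5 m
    rw [tsum_mul_left, Summable.tsum_add h6 ((h2 (N + 1)).mul_left _),
      Summable.tsum_finsetSum fun m _ => h5 m, tsum_mul_left]
    simp only [tsum_mul_left, tsum_diff_mul_sum_eq hu]
    have h4 : d * ∑' k, diffQuot ε u k ^ 2
        = (1 / ε ^ 2) * (d * ∑' k, (u (k + (1 : ℕ)) - u k) ^ 2) := by
      rw [mul_left_comm, ← tsum_mul_left (a := 1 / ε ^ 2)]
      congr 1
      refine tsum_congr fun k => ?_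
      rw [diffQuot]; push_cast; field_simp
    rw [h4]
    exact mul_le_mul_of_nonneg_left h3 (by positivity)
  have s1 : Summable fun k => diffQuot ε u k ^ 2 :=
    summable_of_finite (finite_support_comp (F := fun x => x ^ 2) hD (by simp))
  have s2 : Summable fun k => diffQuot ε u k * grad (N + 1) ρ ε u k :=
    summable_of_finite (finite_support_mul hD _)
  have s3 : Summable fun k => grad (N + 1) ρ ε u k ^ 2 :=
    summable_of_finite (finite_support_comp (F := fun x => x ^ 2) hG (by simp))
  have h5 : ∑' k, 2 * d * (diffQuot ε u k * grad (N + 1) ρ ε u k)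
      ≤ ∑' k, (grad (N + 1) ρ ε u k ^ 2 + d ^ 2 * diffQuot ε u k ^ 2) := by
    refine (s2.mul_left _).tsum_le_tsum (fun k => ?_) (s3.add (s1.mul_left _))
    nlinarith [sq_nonneg (grad (N + 1) ρ ε u k - d * diffQuot ε u k)]
  rw [tsum_mul_left, s3.tsum_add (s1.mul_left _), tsum_mul_left] at h5
  nlinarith [mul_le_mul_of_nonneg_left key hd.le]

/-! ### Interpolations of lattice functions -/

/-- The integral over the line is the sum of the integrals over the cells of the lattice `ε ℤ`. -/
theorem hasSum_integral_cells {h : ℝ → ℝ} (hh : Integrable h volume) {ε : ℝ} (hε : 0 < ε) :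
    HasSum (fun k : ℤ => ∫ x in ε * k..ε * (k + 1), h x) (∫ x, h x) := by
  have h1 := (hh.comp_mul_left' hε.ne').hasSum_intervalIntegral 0
  have h2 := h1.mul_left ε
  rw [Measure.integral_comp_mul_left, abs_of_pos (inv_pos.2 hε), smul_eq_mul,
    mul_inv_cancel_left₀ hε.ne'] at h2
  have e : (fun k : ℤ => ∫ x in ε * k..ε * (k + 1), h x)
      = fun k : ℤ => ε * ∫ x in (0 : ℝ) + k..0 + k + 1, h (ε * x) := funext fun k => ?_
  · rwa [e]
  rw [zero_add, intervalIntegral.integral_comp_mul_left _ hε.ne', smul_eq_mul,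
    mul_inv_cancel_left₀ hε.ne']

theorem measurable_pcInterp (ε : ℝ) (p : ℤ → ℝ) : Measurable (pcInterp ε p) :=
  (measurable_from_top (f := p)).comp (Int.measurable_floor.comp (measurable_id.div_const ε))

theorem floor_div_eq {ε x : ℝ} (hε : 0 < ε) {k : ℤ} (h1 : ε * k ≤ x) (h2 : x < ε * (k + 1)) :
    ⌊x / ε⌋ = k := by
  rw [Int.floor_eq_iff, le_div_iff₀ hε, div_lt_iff₀ hε]
  constructor <;> linarith

theorem mul_floor_div_le {ε : ℝ} (hε : 0 < ε) (x : ℝ) : ε * ⌊x / ε⌋ ≤ x := by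
  rw [mul_comm, ← le_div_iff₀ hε]; exact Int.floor_le _

theorem lt_mul_floor_div_add_one {ε : ℝ} (hε : 0 < ε) (x : ℝ) : x < ε * (⌊x / ε⌋ + 1) := by
  rw [mul_comm, ← div_lt_iff₀ hε]; exact Int.lt_floor_add_one _

theorem pcInterp_add_mul {ε : ℝ} (hε : 0 < ε) (p : ℤ → ℝ) (m : ℤ) (x : ℝ) :
    pcInterp ε p (x + ε * m) = p (⌊x / ε⌋ + m) := by
  unfold pcInterp
  rw [add_div, mul_div_cancel_left₀ _ hε.ne', Int.floor_add_intCast]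

theorem integrable_pcInterp {ε : ℝ} (hε : 0 < ε) {p : ℤ → ℝ} (hp : (Function.support p).Finite) :
    Integrable (pcInterp ε p) volume := by
  have e : pcInterp ε p = fun x => ∑ k ∈ hp.toFinset,
      (Ico (ε * k) (ε * (k + 1))).indicator (fun _ => p k) x := by
    ext x
    have hx : ∀ k : ℤ, x ∈ Ico (ε * k) (ε * (k + 1)) ↔ k = ⌊x / ε⌋ := fun k =>
      ⟨fun h => (floor_div_eq hε h.1 h.2).symm, fun h => by
        rw [h]; exact ⟨mul_floor_div_le hε x, lt_mul_floor_div_add_one hε x⟩⟩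
    simp only [indicator_apply, hx]
    rw [Finset.sum_ite_eq']
    by_cases h : p ⌊x / ε⌋ = 0
    · simp [pcInterp, h]
    · simp [pcInterp, h]
  rw [e]
  refine integrable_finsetSum _ fun k _ => ?_
  exact (integrable_indicator_iff measurableSet_Ico).2 (integrableOn_const (by simp))

theorem integral_pcInterp_cell {ε : ℝ} (hε : 0 < ε) (p : ℤ → ℝ) (k : ℤ) {x : ℝ}
    (h1 : ε * k ≤ x) (h2 : x ≤ ε * (k + 1)) :
    ∫ t in ε * k..x, pcInterp ε p t = (x - ε * k) * p k := by
  rw [intervalIntegral.integral_of_le h1, integral_Ioc_eq_integral_Ioo,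
    setIntegral_congr_fun measurableSet_Ioo (g := fun _ => p k)]
  · simp [h1]
  · intro t ht
    simp only [pcInterp, floor_div_eq hε ht.1.le (ht.2.trans_le h2)]

theorem integral_pcInterp {ε : ℝ} (hε : 0 < ε) {p : ℤ → ℝ} (hp : (Function.support p).Finite) :
    ∫ x, pcInterp ε p x = ∑' k, ε * p k := by
  rw [← (hasSum_integral_cells (integrable_pcInterp hε hp) hε).tsum_eq]
  refine tsum_congr fun k => ?_
  rw [integral_pcInterp_cell hε p k (mul_le_mul_of_nonneg_left (by linarith) hε.le) le_rfl]
  ring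

theorem memLp_pcInterp {ε : ℝ} (hε : 0 < ε) {p : ℤ → ℝ} (hp : (Function.support p).Finite) :
    MemLp (pcInterp ε p) 2 volume :=
  (memLp_two_iff_integrable_sq (measurable_pcInterp ε p).aestronglyMeasurable).2
    (integrable_pcInterp hε (finite_support_comp (F := fun x => x ^ 2) hp (by simp)))

theorem integral_sq_pcInterp {ε : ℝ} (hε : 0 < ε) {p : ℤ → ℝ}
    (hp : (Function.support p).Finite) :
    ∫ x, pcInterp ε p x ^ 2 = ε * ∑' k, p k ^ 2 := by
  rw [← tsum_mul_left]
  exact integral_pcInterp hε (finite_support_comp (F := fun x => x ^ 2) hp (by simp))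

theorem VanishesOutside.finite_support {a b ε : ℝ} (hε : 0 < ε) {u : ℤ → ℝ}
    (hu : VanishesOutside a b ε u) : (Function.support u).Finite := by
  refine (activeSites_finite 1 a b hε).subset fun k hk => ?_
  refine ⟨k, by simp, by simp, ?_⟩
  by_contra h
  exact hk (hu k h)

theorem VanishesOutside.isGradOn {a b ε : ℝ} (hε : 0 < ε) {u : ℤ → ℝ}
    (hu : VanishesOutside a b ε u) :
    IsGradOn (a - ε) (b + ε) (pcInterp ε (diffQuot ε u)) := by
  have hf := hu.finite_support hε
  refine ⟨memLp_pcInterp hε (finite_support_diffQuot hf ε), Eventually.of_forall fun x hx => ?_, ?_⟩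
  · have h1 := mul_floor_div_le hε x
    have h2 := lt_mul_floor_div_add_one hε x
    have e1 : u ⌊x / ε⌋ = 0 := hu _ fun h => hx ⟨by linarith [h.1], by linarith [h.2]⟩
    have e2 : u (⌊x / ε⌋ + 1) = 0 := hu _ fun h => by
      push_cast at h
      exact hx ⟨by linarith [h.1], by linarith [h.2]⟩
    simp [pcInterp, diffQuot, e1, e2]
  · rw [integral_pcInterp hε (finite_support_diffQuot hf ε)]
    have h1 : ∀ k, ε * diffQuot ε u k = u (k + 1) - u k := fun k => by
      rw [diffQuot]; field_simp
    simp only [h1]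
    rw [(summable_of_finite (finite_support_shift hf 1)).tsum_sub (summable_of_finite hf),
      tsum_shift, sub_self]

/-- The piecewise-affine interpolation is the primitive of the piecewise-constant interpolation of
the difference quotients. -/
theorem VanishesOutside.paInterp_eq_prim {a b ε : ℝ} (hε : 0 < ε) {u : ℤ → ℝ}
    (hu : VanishesOutside a b ε u) :
    paInterp ε u = prim (pcInterp ε (diffQuot ε u)) := by
  have hG := hu.isGradOn hε
  set G := pcInterp ε (diffQuot ε u) with hGdef
  have hcell : ∀ (k : ℤ) (x : ℝ), ε * k ≤ x → x ≤ ε * (k + 1) →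
      prim G x - prim G (ε * k) = (x - ε * k) * diffQuot ε u k := fun k x h1 h2 => by
    rw [prim_sub_prim hG.integrable, hGdef, integral_pcInterp_cell hε _ k h1 h2]
  have hnode : ∀ k : ℤ, prim G (ε * k) = u k := by
    have hstep : ∀ k : ℤ, prim G (ε * (k + 1 : ℤ)) - u (k + 1) = prim G (ε * k) - u k := by
      intro k
      have := hcell k (ε * (k + 1)) (mul_le_mul_of_nonneg_left (by linarith) hε.le) le_rfl
      have e : (ε * (k + 1) - ε * k) * diffQuot ε u k = u (k + 1) - u k := by
        rw [diffQuot]; field_simp; ring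
      push_cast
      linarith
    set c : ℤ → ℝ := fun k => prim G (ε * k) - u k with hc
    have hmono : Monotone c := monotone_int_of_le_succ fun k => (hstep k).ge
    have hanti : Antitone c := antitone_int_of_succ_le fun k => (hstep k).le
    -- far to the left both the primitive and the lattice function vanish
    have hleft : ∀ k : ℤ, (k : ℝ) ≤ (a - ε) / ε → c k = 0 := by
      intro k hk
      rw [le_div_iff₀ hε] at hk
      simp only [hc]
      rw [hG.prim_eq_zero fun h => by linarith [h.1], hu k fun h => by linarith [h.1], sub_zero]
    intro k
    have h0 : c (min k ⌊(a - ε) / ε⌋) = 0 :=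
      hleft _ ((Int.cast_le.2 (min_le_right _ _)).trans (Int.floor_le _))
    have h1 : c k = 0 := by
      rw [← h0]
      exact le_antisymm (hanti (min_le_left _ _)) (hmono (min_le_left _ _))
    exact sub_eq_zero.1 h1
  ext x
  have h1 := hcell ⌊x / ε⌋ x (mul_floor_div_le hε x) (lt_mul_floor_div_add_one hε x).le
  rw [hnode] at h1
  rw [paInterp, eq_add_of_sub_eq h1, diffQuot, Int.fract]
  field_simp
  ring

/-! ### Active sites -/

theorem pcInterp_active_le {M : ℕ} {a b ε : ℝ} (hε : 0 < ε) (x : ℝ) :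
    pcInterp ε ((activeSites M a b ε).indicator fun _ => 1) x
      ≤ (Ioo (a - M * ε) (b + M * ε)).indicator (fun _ => 1) x := by
  unfold pcInterp
  by_cases h : ⌊x / ε⌋ ∈ activeSites M a b ε
  · rw [indicator_of_mem h, indicator_of_mem]
    obtain ⟨j, h1, h2, h3, h4⟩ := h
    have h5 : (j : ℝ) ≤ ⌊x / ε⌋ + M := by exact_mod_cast h2
    have h6 : (⌊x / ε⌋ : ℝ) - M + 1 ≤ j := by exact_mod_cast h1
    have h7 := mul_floor_div_le hε x
    have h8 := lt_mul_floor_div_add_one hε x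
    constructor
    · nlinarith
    · nlinarith
  · rw [indicator_of_notMem h]
    exact indicator_nonneg (fun _ _ => zero_le_one) x

theorem le_pcInterp_active {M : ℕ} (hM : 1 ≤ M) {a b ε : ℝ} (hε : 0 < ε) (hεab : ε < b - a)
    (x : ℝ) : (Ioo a b).indicator (fun _ => (1 : ℝ)) x
      ≤ pcInterp ε ((activeSites M a b ε).indicator fun _ => 1) x := by
  unfold pcInterp
  by_cases h : x ∈ Ioo a b
  · have h7 := mul_floor_div_le hε x
    have h8 := lt_mul_floor_div_add_one hε x
    rw [indicator_of_mem h, indicator_of_mem]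
    by_cases h1 : a < ε * ⌊x / ε⌋
    · exact ⟨⌊x / ε⌋, by omega, by omega, h1, h7.trans_lt h.2⟩
    · refine ⟨⌊x / ε⌋ + 1, by omega, by omega, ?_, ?_⟩ <;> push_cast <;> linarith [h.1]
  · rw [indicator_of_notMem h]
    exact indicator_nonneg (fun _ _ => zero_le_one) _

theorem integral_pcInterp_active {M : ℕ} {a b ε : ℝ} (hε : 0 < ε) :
    ∫ x, pcInterp ε ((activeSites M a b ε).indicator fun _ => 1) x
      = ε * (activeSites M a b ε).ncard := by
  have hfin := activeSites_finite M a b hε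
  rw [integral_pcInterp hε (hfin.subset support_indicator_subset), tsum_mul_left,
    ← tsum_subtype (activeSites M a b ε) (fun _ => (1 : ℝ)), tsum_const]
  simp [Nat.card_coe_set_eq]

theorem mul_ncard_activeSites_le {M : ℕ} {a b ε : ℝ} (hab : a ≤ b) (hε : 0 < ε) :
    ε * (activeSites M a b ε).ncard ≤ b - a + 2 * M * ε := by
  rw [← integral_pcInterp_active hε]
  refine (integral_mono (integrable_pcInterp hε ((activeSites_finite M a b hε).subset
    support_indicator_subset)) ((integrable_indicator_iff measurableSet_Ioo).2
      (integrableOn_const (by simp))) fun x => pcInterp_active_le hε x).trans_eq ?_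
  have : 0 ≤ (M : ℝ) * ε := by positivity
  rw [integral_indicator measurableSet_Ioo, setIntegral_const,
    Real.volume_real_Ioo_of_le (by linarith)]
  simp; ring

theorem le_mul_ncard_activeSites {M : ℕ} (hM : 1 ≤ M) {a b ε : ℝ} (hab : a ≤ b) (hε : 0 < ε)
    (hεab : ε < b - a) : b - a ≤ ε * (activeSites M a b ε).ncard := by
  rw [← integral_pcInterp_active hε]
  refine Eq.trans_le ?_ (integral_mono ((integrable_indicator_iff measurableSet_Ioo).2
      (integrableOn_const (by simp))) (integrable_pcInterp hε ((activeSites_finite M a b hε).subset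
    support_indicator_subset)) fun x => le_pcInterp_active hM hε hεab x)
  rw [integral_indicator measurableSet_Ioo, setIntegral_const, Real.volume_real_Ioo_of_le hab]
  simp

theorem tendsto_mul_ncard_activeSites {M : ℕ} (hM : 1 ≤ M) {a b : ℝ} (hab : a < b) {ι : Type*}
    {l : Filter ι} {ε : ι → ℝ} (hε : ∀ i, 0 < ε i) (hlim : Tendsto ε l (𝓝 0)) :
    Tendsto (fun i => ε i * (activeSites M a b (ε i)).ncard) l (𝓝 (b - a)) := by
  refine tendsto_of_tendsto_of_tendsto_of_le_of_le' tendsto_const_nhds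
    (h := fun i => b - a + 2 * M * ε i) ?_ ?_
    (Eventually.of_forall fun i => mul_ncard_activeSites_le hab.le (hε i))
  · simpa using (hlim.const_mul (2 * (M : ℝ))).const_add (b - a)
  · filter_upwards [hlim.eventually (gt_mem_nhds (sub_pos.2 hab))] with i hi
    exact le_mul_ncard_activeSites hM hab.le (hε i) hi

/-- The energy, split into the energy of the normalised density `f - f 0`, which is an integral
over the line, and the contribution of the constant `f 0`. -/
theorem activeEnergy_eq {M : ℕ} (hM : 1 ≤ M) (ρ : ℕ → ℝ) (f : ℝ → ℝ) {a b ε : ℝ} (hε : 0 < ε)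
    {u : ℤ → ℝ} (hu : VanishesOutside a b ε u) :
    activeEnergy M ρ f a b ε u
      = (∫ x, (f (pcInterp ε (grad M ρ ε u) x) - f 0))
        + f 0 * (ε * (activeSites M a b ε).ncard) := by
  have hfin := (activeSites_finite M a b hε).to_subtype
  have h1 := fullEnergy_eq_activeEnergy (ρ := ρ) (f := fun z => f z - f 0) hM (sub_self _) hu
  have h2 : fullEnergy M ρ (fun z => f z - f 0) ε u
      = ∫ x, (f (pcInterp ε (grad M ρ ε u) x) - f 0) := by
    unfold fullEnergy energy
    rw [tsum_univ (fun k : ℤ => ε * (f (grad M ρ ε u k) - f 0))]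
    exact (integral_pcInterp hε (finite_support_comp (F := fun z => f z - f 0)
      (finite_support_grad (hu.finite_support hε) M ρ ε) (sub_self _))).symm
  rw [← h2, h1]
  unfold activeEnergy energy
  have h3 : ∀ k : activeSites M a b ε, ε * f (grad M ρ ε u k)
      = ε * (f (grad M ρ ε u k) - f 0) + f 0 * ε := fun k => by ring
  simp only [h3]
  rw [Summable.tsum_add (Summable.of_finite) (Summable.of_finite), tsum_const,
    Nat.card_coe_set_eq, nsmul_eq_mul]
  ring

/-! ### Convex energy densities of quadratic growth -/

/-- A convex function of quadratic growth has a measurable selection of subgradients, which has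
linear growth. -/
theorem exists_subgradient {f : ℝ → ℝ} (hf : ConvexOn ℝ Set.univ f) {c₀ c₁ c₂ c₃ : ℝ}
    (hc₁ : 0 < c₁) (hc₂ : 0 < c₂) (hf_lower : ∀ z, c₁ * |z| ^ 2 + c₀ ≤ f z)
    (hf_upper : ∀ z, f z ≤ c₂ * |z| ^ 2 + c₃) :
    ∃ (s : ℝ → ℝ) (C : ℝ), Measurable s ∧ 0 ≤ C ∧ (∀ y z, f z + s z * (y - z) ≤ f y) ∧
      ∀ z, |s z| ≤ C * (1 + |z|) := by
  have hsub : ∀ z, ∃ m, ∀ y, f z + m * (y - z) ≤ f y := by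
    intro z
    have hz : z ∈ interior (univ : Set ℝ) := by simp
    refine ⟨derivWithin f (Ioi z) z, fun y => ?_⟩
    rcases lt_trichotomy y z with h | rfl | h
    · have h1 := hf.slope_le_leftDeriv_of_mem_interior (mem_univ y) hz h
      have h2 := h1.trans (hf.leftDeriv_le_rightDeriv_of_mem_interior hz)
      rw [slope_def_field, div_le_iff₀ (sub_pos.2 h)] at h2
      linarith
    · simp
    · have h1 := hf.rightDeriv_le_slope_of_mem_interior hz (mem_univ y) h
      rw [slope_def_field, le_div_iff₀ (sub_pos.2 h)] at h1
      linarith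
  choose s hs using hsub
  have hmono : Monotone s := by
    intro y z hyz
    rcases hyz.eq_or_lt with rfl | h
    · exact le_rfl
    · have h1 := hs y z
      have h2 := hs z y
      by_contra hlt
      nlinarith [mul_pos (sub_pos.2 h) (sub_pos.2 (not_le.1 hlt))]
  refine ⟨s, 4 * c₂ + |c₃ - c₀|, hmono.measurable, by positivity, fun y z => hs z y, fun z => ?_⟩
  -- test the subgradient inequality at distance `1 + |z|` on either side of `z`
  have hup : ∀ y, |y| ≤ 2 * (1 + |z|) → f y - f z ≤ (4 * c₂ + |c₃ - c₀|) * (1 + |z|) ^ 2 := by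
    intro y hy
    have h1 : |y| ^ 2 ≤ (2 * (1 + |z|)) ^ 2 := pow_le_pow_left₀ (abs_nonneg y) hy 2
    have h2 := hf_upper y
    have h3 := hf_lower z
    have h4 : 0 ≤ c₁ * |z| ^ 2 := by positivity
    have h5 : (1 : ℝ) ≤ (1 + |z|) ^ 2 := by nlinarith [abs_nonneg z]
    have h6 := mul_le_mul_of_nonneg_left h1 hc₂.le
    have h7 := mul_le_mul_of_nonneg_left h5 (abs_nonneg (c₃ - c₀))
    nlinarith [le_abs_self (c₃ - c₀)]
  have hz := abs_nonneg z
  have hpos : 0 < 1 + |z| := by linarith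
  have hr := hs z (z + (1 + |z|))
  have hl := hs z (z - (1 + |z|))
  have hr' := hup (z + (1 + |z|)) (by
    have := abs_add_le z (1 + |z|)
    rw [abs_of_pos hpos] at this; linarith)
  have hl' := hup (z - (1 + |z|)) (by
    have := abs_sub z (1 + |z|)
    rw [abs_of_pos hpos] at this; linarith)
  rw [abs_le]
  constructor
  · refine le_of_mul_le_mul_right ?_ hpos
    nlinarith
  · refine le_of_mul_le_mul_right ?_ hpos
    nlinarith

theorem continuous_of_convexOn_univ {f : ℝ → ℝ} (hf : ConvexOn ℝ Set.univ f) : Continuous f :=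
  continuousOn_univ.1 (hf.continuousOn isOpen_univ)

section Density

variable {f s : ℝ → ℝ} {C : ℝ}

theorem abs_sub_zero_le (hs : ∀ y z, f z + s z * (y - z) ≤ f y) (hC : 0 ≤ C)
    (hsC : ∀ z, |s z| ≤ C * (1 + |z|)) (z : ℝ) : |f z - f 0| ≤ C * (|z| + z ^ 2) := by
  have h1 := hs z 0
  have h2 := hs 0 z
  have hz := abs_nonneg z
  have h3 : |s 0 * z| ≤ C * |z| := by
    rw [abs_mul]
    exact mul_le_mul_of_nonneg_right (by simpa using hsC 0) hz
  have h4 : |s z * z| ≤ C * (|z| + z ^ 2) := by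
    rw [abs_mul, ← sq_abs z]
    nlinarith [mul_le_mul_of_nonneg_right (hsC z) hz]
  have h5 : 0 ≤ C * z ^ 2 := by positivity
  rw [abs_le] at h3 h4 ⊢
  constructor <;> nlinarith

theorem integrable_density (hfc : Continuous f) (hs : ∀ y z, f z + s z * (y - z) ≤ f y)
    (hC : 0 ≤ C) (hsC : ∀ z, |s z| ≤ C * (1 + |z|)) {g : ℝ → ℝ} (hg : Integrable g volume)
    (hg2 : MemLp g 2 volume) : Integrable (fun x => f (g x) - f 0) volume := by
  refine Integrable.mono' ((hg.abs.add hg2.integrable_sq).const_mul C)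
    ((hfc.comp_aestronglyMeasurable hg.1).sub aestronglyMeasurable_const)
    (Eventually.of_forall fun x => ?_)
  exact abs_sub_zero_le hs hC hsC (g x)

theorem memLp_subgradient (hsm : Measurable s) (hC : 0 ≤ C) (hsC : ∀ z, |s z| ≤ C * (1 + |z|))
    {g : ℝ → ℝ} (hg2 : MemLp g 2 volume) (A B : ℝ) :
    MemLp ((Ioo A B).indicator fun x => s (g x)) 2 volume := by
  rw [memLp_indicator_iff_restrict measurableSet_Ioo]
  have h0 : MemLp (fun x => 1 + ‖g x‖) 2 (volume.restrict (Ioo A B)) :=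
    (memLp_const (1 : ℝ)).add (hg2.restrict (Ioo A B)).norm
  have h1 : MemLp (fun x => C * (1 + ‖g x‖)) 2 (volume.restrict (Ioo A B)) := h0.const_mul C
  refine h1.mono (hsm.comp_aemeasurable hg2.1.aemeasurable).aestronglyMeasurable.restrict
    (Eventually.of_forall fun x => ?_)
  have : 0 ≤ C * (1 + ‖g x‖) := by positivity
  rw [Real.norm_of_nonneg this]
  exact hsC _

/-- The integrated subgradient inequality. -/
theorem density_integral_ge (hfc : Continuous f) (hsm : Measurable s)
    (hs : ∀ y z, f z + s z * (y - z) ≤ f y)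
    (hC : 0 ≤ C) (hsC : ∀ z, |s z| ≤ C * (1 + |z|)) {A B : ℝ} {g G : ℝ → ℝ}
    (hg : MemLp g 2 volume) (hg0 : ∀ᵐ x, x ∉ Ioo A B → g x = 0)
    (hG : MemLp G 2 volume) (hG0 : ∀ᵐ x, x ∉ Ioo A B → G x = 0) :
    (∫ x, (f (g x) - f 0)) + ((∫ x, G x * (Ioo A B).indicator (fun x => s (g x)) x)
      - ∫ x, g x * (Ioo A B).indicator (fun x => s (g x)) x) ≤ ∫ x, (f (G x) - f 0) := by
  have hh := memLp_subgradient hsm hC hsC hg A B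
  have hgi := integrable_of_memLp_of_ae_zero hg hg0
  have hGi := integrable_of_memLp_of_ae_zero hG hG0
  have i1 := integrable_density hfc hs hC hsC hgi hg
  have i2 := integrable_mul_of_memLp_two hG hh
  have i3 := integrable_mul_of_memLp_two hg hh
  have i4 := i2.sub i3
  simp only [Pi.sub_def] at i4
  rw [← integral_sub i2 i3, ← integral_add i1 i4]
  refine integral_mono_ae (i1.add i4) (integrable_density hfc hs hC hsC hGi hG) ?_
  filter_upwards [hg0, hG0] with x h1 h2
  by_cases hx : x ∈ Ioo A B
  · simp only [indicator_of_mem hx]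
    linarith [hs (G x) (g x)]
  · simp [h1 hx, h2 hx]

/-- For functions vanishing outside `(a, b)`, the integral of the normalised density over the line
determines the integral of the density over `(a, b)`. -/
theorem setIntegral_density_eq (hfc : Continuous f) (hs : ∀ y z, f z + s z * (y - z) ≤ f y)
    (hC : 0 ≤ C) (hsC : ∀ z, |s z| ≤ C * (1 + |z|)) {a b : ℝ} (hab : a ≤ b) {g : ℝ → ℝ}
    (hg : MemLp g 2 volume) (hg0 : ∀ᵐ x, x ∉ Ioo a b → g x = 0) :
    ∫ x in Ioo a b, f (g x) = (∫ x, (f (g x) - f 0)) + f 0 * (b - a) := by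
  have hgi := integrable_of_memLp_of_ae_zero hg hg0
  have i1 := integrable_density hfc hs hC hsC hgi hg
  have h1 : ∫ x, (f (g x) - f 0) = ∫ x in Ioo a b, (f (g x) - f 0) := by
    symm
    rw [setIntegral_eq_integral_of_ae_compl_eq_zero]
    filter_upwards [hg0] with x h1 h2
    rw [h1 h2, sub_self]
  have h2 : ∫ x in Ioo a b, f 0 = f 0 * (b - a) := by
    simp [hab, mul_comm]
  rw [h1, ← h2, ← integral_add i1.integrableOn (integrableOn_const (by simp))]
  simp

end Density

/-! ### Bounds on the difference quotients -/

/-- An energy bound controls the difference quotients in `L²`, uniformly in the scale. -/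
theorem exists_bound_diffQuot {M : ℕ} (hM : 1 ≤ M) {ρ : ℕ → ℝ}
    (hρ_pos : ∀ i ∈ Set.Icc 1 M, 0 < ρ i) (hρ_anti : StrictAntiOn ρ (Set.Icc 1 M))
    {f : ℝ → ℝ} {c₀ c₁ : ℝ} (hc₁ : 0 < c₁) (hf_lower : ∀ z, c₁ * |z| ^ 2 + c₀ ≤ f z)
    {a b : ℝ} (hab : a < b) (C : ℝ) :
    ∃ R : ℝ, ∀ ε : ℝ, 0 < ε → ε < 1 / (2 * M) → ∀ u : ℤ → ℝ, VanishesOutside a b ε u →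
      activeEnergy M ρ f a b ε u ≤ C → ∫ x, pcInterp ε (diffQuot ε u) x ^ 2 ≤ R := by
  obtain ⟨c, hc, hcoer⟩ := exists_coercive hM hρ_pos hρ_anti
  refine ⟨(C + |c₀| * (b - a + 1)) / (c₁ * c), fun ε hε hεM u hu hE => ?_⟩
  have hfs := hu.finite_support hε
  have hMpos : (0 : ℝ) < M := by exact_mod_cast hM
  rw [lt_div_iff₀ (by positivity)] at hεM
  have hfin := (activeSites_finite M a b hε).to_subtype
  have hN := mul_ncard_activeSites_le (M := M) hab.le hε
  have h1 : ∑' k : activeSites M a b ε, (c₁ * ε * grad M ρ ε u k ^ 2 + c₀ * ε)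
      ≤ activeEnergy M ρ f a b ε u := by
    refine Summable.tsum_le_tsum (fun k => ?_) Summable.of_finite Summable.of_finite
    have := mul_le_mul_of_nonneg_left (hf_lower (grad M ρ ε u k)) hε.le
    rw [sq_abs] at this
    linarith
  rw [Summable.tsum_add Summable.of_finite Summable.of_finite, tsum_const, Nat.card_coe_set_eq,
    nsmul_eq_mul, tsum_mul_left] at h1
  have h2 : ∑' k : activeSites M a b ε, grad M ρ ε u k ^ 2 = ∑' k, grad M ρ ε u k ^ 2 := by
    refine tsum_subtype_eq_of_support_subset (f := fun k : ℤ => grad M ρ ε u k ^ 2) fun k hk => ?_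
    by_contra h
    exact hk (by simp [grad_eq_zero hM hu h])
  rw [h2] at h1
  have h3 := hcoer ε u hε hfs
  rw [integral_sq_pcInterp hε (finite_support_diffQuot hfs ε), le_div_iff₀ (by positivity)]
  have h4 : -(|c₀| * (b - a + 1)) ≤ c₀ * (ε * (activeSites M a b ε).ncard) := by
    have h5 : 0 ≤ ε * ((activeSites M a b ε).ncard : ℝ) := by positivity
    have h6 := mul_le_mul_of_nonneg_right (neg_abs_le c₀) h5
    have h7 : ε * ((activeSites M a b ε).ncard : ℝ) ≤ b - a + 1 := by linarith
    have h8 := mul_le_mul_of_nonneg_left h7 (abs_nonneg c₀)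
    linarith
  have h5 := mul_le_mul_of_nonneg_left h3 (mul_pos hc₁ hε).le
  linarith

/-! ### Interpolations between piecewise constant and piecewise affine -/

/-- Interpolations of lattice functions whose values on a cell are convex combinations of the
values at its two end points. The weights depend only on the scale and on the point. -/
def IsInterp (I : ℝ → (ℤ → ℝ) → ℝ → ℝ) : Prop :=
  ∃ θ : ℝ → ℝ → ℝ, (∀ ε, Measurable (θ ε)) ∧ (∀ ε x, θ ε x ∈ Icc (0 : ℝ) 1) ∧
    ∀ ε u x, I ε u x = u ⌊x / ε⌋ + θ ε x * (u (⌊x / ε⌋ + 1) - u ⌊x / ε⌋)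

theorem isInterp_pcInterp : IsInterp pcInterp :=
  ⟨fun _ _ => 0, fun _ => measurable_const, fun _ _ => by simp, fun _ _ _ => by simp [pcInterp]⟩

theorem isInterp_paInterp : IsInterp paInterp :=
  ⟨fun ε x => Int.fract (x / ε), fun ε => measurable_fract.comp (measurable_id.div_const ε),
    fun _ _ => ⟨Int.fract_nonneg _, (Int.fract_lt_one _).le⟩, fun _ _ _ => rfl⟩

namespace IsInterp

variable {I : ℝ → (ℤ → ℝ) → ℝ → ℝ}

theorem measurable (hI : IsInterp I) (ε : ℝ) (u : ℤ → ℝ) : Measurable (I ε u) := by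
  obtain ⟨θ, h1, -, h3⟩ := hI
  have e : I ε u = fun x => pcInterp ε u x
      + θ ε x * (pcInterp ε (fun k => u (k + 1)) x - pcInterp ε u x) := funext fun x => h3 ε u x
  rw [e]
  exact (measurable_pcInterp ε u).add
    ((h1 ε).mul ((measurable_pcInterp ε _).sub (measurable_pcInterp ε u)))

theorem abs_sub_le (hI : IsInterp I) (ε : ℝ) (u : ℤ → ℝ) (x : ℝ) :
    |I ε u x - u ⌊x / ε⌋| ≤ |u (⌊x / ε⌋ + 1) - u ⌊x / ε⌋| := by
  obtain ⟨θ, -, h2, h3⟩ := hI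
  rw [h3, add_sub_cancel_left, abs_mul, abs_of_nonneg (h2 ε x).1]
  exact mul_le_of_le_one_left (abs_nonneg _) (h2 ε x).2

theorem abs_sub_paInterp_le (hI : IsInterp I) {ε : ℝ} (hε : 0 < ε) (u : ℤ → ℝ) (x : ℝ) :
    |I ε u x - paInterp ε u x| ≤ ε * |pcInterp ε (diffQuot ε u) x| := by
  obtain ⟨θ, -, h2, h3⟩ := hI
  have e : I ε u x - paInterp ε u x
      = (θ ε x - Int.fract (x / ε)) * (ε * pcInterp ε (diffQuot ε u) x) := by
    rw [h3, paInterp, pcInterp, diffQuot]; field_simp; ring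
  rw [e, abs_mul, abs_mul, abs_of_pos hε]
  refine mul_le_of_le_one_left (by positivity) ?_
  have h4 := h2 ε x
  rw [abs_le]
  constructor <;> linarith [h4.1, h4.2, Int.fract_nonneg (x / ε), Int.fract_lt_one (x / ε)]

theorem memLp_sub_paInterp (hI : IsInterp I) {a b ε : ℝ} (hε : 0 < ε) {u : ℤ → ℝ}
    (hu : VanishesOutside a b ε u) : MemLp (fun x => I ε u x - paInterp ε u x) 2 volume := by
  refine (((hu.isGradOn hε).memLp.norm).const_mul ε).mono
    ((hI.measurable ε u).sub (isInterp_paInterp.measurable ε u)).aestronglyMeasurable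
    (Eventually.of_forall fun x => ?_)
  rw [norm_mul, norm_norm, Real.norm_of_nonneg hε.le]
  exact hI.abs_sub_paInterp_le hε u x

theorem memLp (hI : IsInterp I) {a b ε : ℝ} (hε : 0 < ε) {u : ℤ → ℝ}
    (hu : VanishesOutside a b ε u) : MemLp (I ε u) 2 volume := by
  have h1 : MemLp (paInterp ε u) 2 volume := by
    rw [hu.paInterp_eq_prim hε]; exact (hu.isGradOn hε).memLp_prim
  have h2 := (hI.memLp_sub_paInterp hε hu).add h1
  convert h2 using 1
  ext x; simp

theorem integral_sq_sub_paInterp_le (hI : IsInterp I) {a b ε : ℝ} (hε : 0 < ε) {u : ℤ → ℝ}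
    (hu : VanishesOutside a b ε u) :
    ∫ x, (I ε u x - paInterp ε u x) ^ 2 ≤ ε ^ 2 * ∫ x, pcInterp ε (diffQuot ε u) x ^ 2 := by
  rw [← integral_const_mul]
  refine integral_mono (hI.memLp_sub_paInterp hε hu).integrable_sq
    ((hu.isGradOn hε).memLp.integrable_sq.const_mul _) fun x => ?_
  have h := hI.abs_sub_paInterp_le hε u x
  have h2 := pow_le_pow_left₀ (abs_nonneg _) h 2
  rwa [sq_abs, mul_pow, sq_abs] at h2

end IsInterp

/-! ### Weak limits -/

/-- The nonlocal gradient is a weighted sum of translated difference quotients. -/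
theorem pcInterp_grad_eq {M : ℕ} {ρ : ℕ → ℝ} {ε : ℝ} (hε : 0 < ε) (u : ℤ → ℝ) (x : ℝ) :
    pcInterp ε (grad M ρ ε u) x = ∑ j ∈ Finset.range M, ρ (j + 1) *
      ∑ i ∈ Finset.range (2 * j + 1),
        pcInterp ε (diffQuot ε u) (x + ε * ((i - j : ℤ) : ℝ)) := by
  simp only [pcInterp_add_mul hε]
  rw [pcInterp, grad_eq, Finset.mul_sum]
  refine Finset.sum_congr rfl fun j _ => ?_
  rw [mul_left_comm]
  congr 1
  have h := Finset.sum_range_sub (fun i : ℕ => u (⌊x / ε⌋ + (i - j : ℤ)) / ε) (2 * j + 1)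
  have h2 : ∀ i : ℕ, u (⌊x / ε⌋ + ((i + 1 : ℕ) - j : ℤ)) / ε - u (⌊x / ε⌋ + (i - j : ℤ)) / ε
      = diffQuot ε u (⌊x / ε⌋ + (i - j : ℤ)) := by
    intro i
    rw [diffQuot, sub_div]
    congr 3
    push_cast; ring
  simp only [h2] at h
  rw [h]
  push_cast
  rw [show (2 * (j : ℤ) + 1 - j) = j + 1 by ring, zero_sub]
  ring

theorem sum_weights_eq {M : ℕ} {ρ : ℕ → ℝ} {K : ℝ}
    (hK : K = ∑ j ∈ Finset.Icc 1 M, (2 * (j : ℝ) - 1) * ρ j) :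
    K = ∑ j ∈ Finset.range M, ρ (j + 1) * (2 * j + 1) := by
  rw [hK, ← Finset.Ico_add_one_right_eq_Icc, Finset.sum_Ico_eq_sum_range]
  simp only [Nat.add_sub_cancel]
  refine Finset.sum_congr rfl fun j _ => ?_
  rw [add_comm 1 j]; push_cast; ring

/-- If the difference quotients converge weakly to `g`, the nonlocal gradients converge weakly
to `K g`. -/
theorem tendsto_integral_grad_mul {M : ℕ} {ρ : ℕ → ℝ} {K : ℝ}
    (hK : K = ∑ j ∈ Finset.Icc 1 M, (2 * (j : ℝ) - 1) * ρ j)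
    {ι : Type*} {l : Filter ι} {ε : ι → ℝ} (hε : ∀ i, 0 < ε i) (hlim : Tendsto ε l (𝓝 0))
    {u : ι → ℤ → ℝ} (hu : ∀ i, (Function.support (u i)).Finite) {R : ℝ}
    (hR : ∀ i, ∫ x, pcInterp (ε i) (diffQuot (ε i) (u i)) x ^ 2 ≤ R) {g h : ℝ → ℝ}
    (hh : MemLp h 2 volume)
    (hw : Tendsto (fun i => ∫ x, pcInterp (ε i) (diffQuot (ε i) (u i)) x * h x) l
      (𝓝 (∫ x, g x * h x))) :
    Tendsto (fun i => ∫ x, pcInterp (ε i) (grad M ρ (ε i) (u i)) x * h x) l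
      (𝓝 (K * ∫ x, g x * h x)) := by
  have hD : ∀ i, MemLp (pcInterp (ε i) (diffQuot (ε i) (u i))) 2 volume := fun i =>
    memLp_pcInterp (hε i) (finite_support_diffQuot (hu i) _)
  have h1 : ∀ m : ℤ, Tendsto
      (fun i => ∫ x, pcInterp (ε i) (diffQuot (ε i) (u i)) (x + ε i * (m : ℝ)) * h x) l
      (𝓝 (∫ x, g x * h x)) := fun m =>
    tendsto_integral_translate_mul hD hR hh hw (by simpa using hlim.mul_const (m : ℝ))
  have h2 : ∀ i, ∫ x, pcInterp (ε i) (grad M ρ (ε i) (u i)) x * h x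
      = ∑ j ∈ Finset.range M, ρ (j + 1) * ∑ m ∈ Finset.range (2 * j + 1),
        ∫ x, pcInterp (ε i) (diffQuot (ε i) (u i)) (x + ε i * ((m - j : ℤ) : ℝ)) * h x := by
    intro i
    have hi : ∀ t : ℝ, Integrable
        (fun x => pcInterp (ε i) (diffQuot (ε i) (u i)) (x + t) * h x) volume := fun t =>
      integrable_mul_of_memLp_two (memLp_comp_add_right (hD i) t) hh
    simp only [pcInterp_grad_eq (hε i), Finset.sum_mul, Finset.mul_sum, mul_assoc]
    rw [integral_finsetSum _ fun j _ => integrable_finsetSum _ fun m _ => (hi _).const_mul _]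
    refine Finset.sum_congr rfl fun j _ => ?_
    rw [integral_finsetSum _ fun m _ => (hi _).const_mul _]
    refine Finset.sum_congr rfl fun m _ => ?_
    rw [integral_const_mul]
  simp only [h2]
  have h3 : K * ∫ x, g x * h x = ∑ j ∈ Finset.range M, ρ (j + 1) *
      ∑ m ∈ Finset.range (2 * j + 1), ∫ x, g x * h x := by
    rw [sum_weights_eq hK, Finset.sum_mul]
    refine Finset.sum_congr rfl fun j _ => ?_
    simp; ring
  rw [h3]
  exact tendsto_finsetSum _ fun j _ => (tendsto_finsetSum _ fun m _ => h1 _).const_mul _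

/-- Weak limits of weak derivatives of functions in `H¹₀(a - ε, b + ε)`, as `ε → 0`. -/
theorem isGradOn_of_weak_limit {a b : ℝ} {ι : Type*} {l : Filter ι} [l.NeBot]
    {ε : ι → ℝ} (hε1 : ∀ i, ε i < 1) (hlim : Tendsto ε l (𝓝 0)) {D : ι → ℝ → ℝ}
    (hD : ∀ i, IsGradOn (a - ε i) (b + ε i) (D i)) {g : ℝ → ℝ} (hg : MemLp g 2 volume)
    (hw : ∀ h : ℝ → ℝ, MemLp h 2 volume →
      Tendsto (fun i => ∫ x, D i x * h x) l (𝓝 (∫ x, g x * h x))) : IsGradOn a b g := by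
  have hz : ∀ δ : ℝ, 0 < δ → ∀ᵐ x, x ∉ Ioo (a - δ) (b + δ) → g x = 0 := by
    intro δ hδ
    -- test with the restriction of `g` to the complement of the enlarged interval
    have hm : MeasurableSet (Ioo (a - δ) (b + δ))ᶜ := measurableSet_Ioo.compl
    have h1 := hw _ (hg.indicator hm)
    have h2 : ∀ᶠ i in l, (0 : ℝ) = ∫ x, D i x * (Ioo (a - δ) (b + δ))ᶜ.indicator g x := by
      filter_upwards [hlim.eventually (gt_mem_nhds hδ)] with i hi
      symm
      refine integral_eq_zero_of_ae ?_
      filter_upwards [(hD i).ae_zero] with x hx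
      by_cases h : x ∈ Ioo (a - δ) (b + δ)
      · simp [h]
      · rw [hx fun h' => h (Ioo_subset_Ioo (by linarith) (by linarith) h')]; simp
    have h3 := tendsto_nhds_unique h1 (tendsto_const_nhds.congr' h2)
    have h4 : ∫ x in (Ioo (a - δ) (b + δ))ᶜ, g x ^ 2 = 0 := by
      rw [← h3, ← integral_indicator hm]
      refine integral_congr_ae (Eventually.of_forall fun x => ?_)
      by_cases h : x ∈ (Ioo (a - δ) (b + δ))ᶜ
      · simp only [indicator_of_mem h]; ring
      · simp only [indicator_of_notMem h]; ring
    rw [setIntegral_eq_zero_iff_of_nonneg_ae (Eventually.of_forall fun x => sq_nonneg _)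
      hg.integrable_sq.integrableOn, EventuallyEq, ae_restrict_iff' hm] at h4
    filter_upwards [h4] with x hx h
    simpa using hx h
  have h0 : ∀ᵐ x, x ∉ Ioo a b → g x = 0 := by
    have h1 : ∀ᵐ x, ∀ n : ℕ, x ∉ Ioo (a - 1 / ((n : ℝ) + 1)) (b + 1 / ((n : ℝ) + 1)) → g x = 0 :=
      ae_all_iff.2 fun n => hz _ (by positivity)
    have h2 : ∀ᵐ x : ℝ, x ≠ a := by simp [ae_iff]
    have h3 : ∀ᵐ x : ℝ, x ≠ b := by simp [ae_iff]
    filter_upwards [h1, h2, h3] with x k1 k2 k3 hx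
    rw [mem_Ioo, not_and_or, not_lt, not_lt] at hx
    rcases hx with hx | hx
    · obtain ⟨n, hn⟩ := exists_nat_one_div_lt (sub_pos.2 (lt_of_le_of_ne hx k2))
      exact k1 n fun h => by linarith [h.1]
    · obtain ⟨n, hn⟩ := exists_nat_one_div_lt (sub_pos.2 (lt_of_le_of_ne hx (Ne.symm k3)))
      exact k1 n fun h => by linarith [h.2]
  refine ⟨hg, h0, ?_⟩
  have hJ : ∀ v : ℝ → ℝ, (∀ᵐ x, x ∉ Ioo (a - 1) (b + 1) → v x = 0) →
      ∫ x, v x * (Ioo (a - 1) (b + 1)).indicator (fun _ => (1 : ℝ)) x = ∫ x, v x := by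
    intro v hv
    rw [← setIntegral_eq_integral_mul_indicator measurableSet_Ioo,
      setIntegral_eq_integral_of_ae_compl_eq_zero hv]
  have h1 := hw _ (memLp_indicator_one (μ := volume) (measurableSet_Ioo (a := a - 1) (b := b + 1))
    (by simp))
  rw [hJ g (h0.mono fun x hx h => hx fun h' =>
    h (Ioo_subset_Ioo (by linarith) (by linarith) h'))] at h1
  refine tendsto_nhds_unique h1 (tendsto_const_nhds.congr fun i => ?_)
  rw [hJ _ ((hD i).mono (by linarith [hε1 i]) (by linarith [hε1 i])).ae_zero, (hD i).mean_zero]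

/-- Weak convergence passes to primitives, tested against smooth functions. -/
theorem tendsto_integral_prim_mul {A B : ℝ} (hAB : A ≤ B) {ι : Type*} {l : Filter ι}
    {D : ι → ℝ → ℝ} (hD : ∀ i, IsGradOn A B (D i)) {g : ℝ → ℝ} (hg : IsGradOn A B g)
    (hw : ∀ h : ℝ → ℝ, MemLp h 2 volume →
      Tendsto (fun i => ∫ x, D i x * h x) l (𝓝 (∫ x, g x * h x)))
    {φ : ℝ → ℝ} (hφ : Continuous φ) :
    Tendsto (fun i => ∫ x, prim (D i) x * φ x) l (𝓝 (∫ x, prim g x * φ x)) := by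
  set Φ : ℝ → ℝ := fun x => ∫ t in (0 : ℝ)..x, φ t
  have hd : deriv Φ = φ := funext fun x => hφ.deriv_integral φ 0 x
  have hdiff : Differentiable ℝ Φ := fun x =>
    (intervalIntegral.integral_hasDerivAt_right (hφ.intervalIntegrable _ _)
      (hφ.stronglyMeasurableAtFilter _ _) hφ.continuousAt).differentiableAt
  have hC : ContDiff ℝ 1 Φ := contDiff_one_iff_deriv.2 ⟨hdiff, by rwa [hd]⟩
  have key : ∀ v, IsGradOn A B v →
      ∫ x, prim v x * φ x = - ∫ x, v x * (Ioo A B).indicator Φ x := by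
    intro v hv
    rw [← hd, hv.integral_prim_mul_deriv hAB hC]
    congr 1
    refine integral_congr_ae ?_
    filter_upwards [hv.ae_zero] with x hx
    by_cases h : x ∈ Ioo A B
    · rw [indicator_of_mem h]
    · rw [hx h, zero_mul, zero_mul]
  have hm : MemLp ((Ioo A B).indicator Φ) 2 volume := by
    rw [memLp_indicator_iff_restrict measurableSet_Ioo]
    obtain ⟨c, hc⟩ := isCompact_Icc.exists_bound_of_continuousOn
      (hC.continuous.continuousOn (s := Icc A B))
    refine MemLp.of_bound hC.continuous.aestronglyMeasurable c ?_
    filter_upwards [ae_restrict_mem measurableSet_Ioo] with x hx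
    exact hc x (Ioo_subset_Icc_self hx)
  rw [key g hg]
  exact (hw _ hm).neg.congr fun i => (key _ (hD i)).symm

/-! ### The liminf inequality -/

theorem tendsto_integral_of_tendsto_weak {ι : Type*} {l : Filter ι}
    {v : ι → Lp ℝ 2 (volume : Measure ℝ)} {w : Lp ℝ 2 (volume : Measure ℝ)}
    (h : Tendsto (fun i => toWeakSpace ℝ _ (v i)) l (𝓝 (toWeakSpace ℝ _ w)))
    {φ : ℝ → ℝ} (hφ : MemLp φ 2 volume) :
    Tendsto (fun i => ∫ x, v i x * φ x) l (𝓝 (∫ x, w x * φ x)) := by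
  have e : ∀ v : Lp ℝ 2 (volume : Measure ℝ),
      innerSL ℝ (hφ.toLp φ) v = ∫ x, v x * φ x := fun v => by
    rw [innerSL_apply_apply, real_inner_comm, ← inner_toLp_toLp (Lp.memLp v) hφ, Lp.toLp_coeFn]
  have h1 : Continuous fun x : WeakSpace ℝ (Lp ℝ 2 (volume : Measure ℝ)) =>
      (topDualPairing ℝ (Lp ℝ 2 (volume : Measure ℝ))).flip x (innerSL ℝ (hφ.toLp φ)) :=
    WeakBilin.eval_continuous _ _
  have h2 := (h1.tendsto _).comp h
  rw [← e w]
  exact h2.congr fun i => e (v i)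

theorem pcInterp_grad_eq_zero {M : ℕ} (hM : 1 ≤ M) {ρ : ℕ → ℝ} {a b ε : ℝ} (hε : 0 < ε)
    {u : ℤ → ℝ} (hu : VanishesOutside a b ε u) {x : ℝ}
    (hx : x ∉ Ioo (a - M * ε) (b + M * ε)) : pcInterp ε (grad M ρ ε u) x = 0 := by
  refine grad_eq_zero hM hu fun h => ?_
  have h1 := pcInterp_active_le (M := M) (a := a) (b := b) hε x
  rw [indicator_of_notMem hx, pcInterp, indicator_of_mem h] at h1
  exact absurd h1 (by norm_num)

/-- The compactness and lower semicontinuity statement behind the liminf inequality, along an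
ultrafilter: the difference quotients converge weakly to some `g`, the limit is the primitive of
`g`, and the convexity of `f` in the form of its subgradient inequality at `K g` gives the bound on
the limit energy. -/
theorem exists_isGradOn_of_energy_le {M : ℕ} (hM : 1 ≤ M) {ρ : ℕ → ℝ}
    (hρ_pos : ∀ i ∈ Set.Icc 1 M, 0 < ρ i) (hρ_anti : StrictAntiOn ρ (Set.Icc 1 M))
    {f : ℝ → ℝ} (hf : ConvexOn ℝ Set.univ f) {c₀ c₁ c₂ c₃ : ℝ} (hc₁ : 0 < c₁) (hc₂ : 0 < c₂)
    (hf_lower : ∀ z, c₁ * |z| ^ 2 + c₀ ≤ f z) (hf_upper : ∀ z, f z ≤ c₂ * |z| ^ 2 + c₃)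
    {a b : ℝ} (hab : a < b) {K : ℝ} (hK : K = ∑ j ∈ Finset.Icc 1 M, (2 * (j : ℝ) - 1) * ρ j)
    {I : ℝ → (ℤ → ℝ) → ℝ → ℝ} (hI : IsInterp I) {ι : Type*} (l : Ultrafilter ι) {ε : ι → ℝ}
    (hε : ∀ i, 0 < ε i) (hεM : ∀ i, ε i < 1 / (2 * M)) (hlim : Tendsto ε l (𝓝 0))
    {u : ι → ℤ → ℝ} (hu : ∀ i, VanishesOutside a b (ε i) (u i)) {c : ℝ}
    (hE : ∀ i, activeEnergy M ρ f a b (ε i) (u i) ≤ c) {w : ℝ → ℝ} (hwm : MemLp w 2 volume)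
    (hw : ∀ φ : ℝ → ℝ, MemLp φ 2 volume →
      Tendsto (fun i => ∫ x, I (ε i) (u i) x * φ x) l (𝓝 (∫ x, w x * φ x))) :
    ∃ g, IsGradOn a b g ∧ w =ᵐ[volume] prim g ∧ ∫ x in Ioo a b, f (K * g x) ≤ c := by
  obtain ⟨R, hR⟩ := exists_bound_diffQuot hM hρ_pos hρ_anti hc₁ hf_lower hab c
  have hR' := fun i => hR (ε i) (hε i) (hεM i) (u i) (hu i) (hE i)
  have hMpos : (1 : ℝ) ≤ M := by exact_mod_cast hM
  have hMε : ∀ i, M * ε i < 1 := fun i => by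
    have := hεM i
    rw [lt_div_iff₀ (by positivity)] at this
    linarith
  have hε1 : ∀ i, ε i < 1 := fun i => by nlinarith [hMε i, hε i]
  have hD := fun i => (hu i).isGradOn (hε i)
  obtain ⟨g, hgm, hg⟩ := exists_weak_limit l (fun i => (hD i).memLp) hR'
  have hG : IsGradOn a b g := isGradOn_of_weak_limit hε1 hlim hD hgm hg
  have hD' := fun i => (hD i).mono (A' := a - 1) (B' := b + 1)
    (by linarith [hε1 i]) (by linarith [hε1 i])
  have hG' := hG.mono (A' := a - 1) (B' := b + 1) (by linarith) (by linarith)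
  refine ⟨g, hG, ?_, ?_⟩
  · -- the interpolations and their piecewise-affine variants have the same weak limit
    refine ae_eq_of_integral_contDiff_smul_eq (hwm.locallyIntegrable one_le_two)
      (hG.memLp_prim.locallyIntegrable one_le_two) fun φ hφ1 hφ2 => ?_
    have hφ : MemLp φ 2 volume := hφ1.continuous.memLp_of_hasCompactSupport hφ2
    have h1 := tendsto_integral_prim_mul (by linarith) hD' hG' hg hφ1.continuous
    have h2 : Tendsto (fun i => ∫ x, (I (ε i) (u i) x - paInterp (ε i) (u i) x) * φ x) l
        (𝓝 0) := by
      have h3 : Tendsto (fun i => √(ε i ^ 2 * R * ∫ x, φ x ^ 2)) l (𝓝 0) := by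
        have h4 := (Real.continuous_sqrt.tendsto _).comp
          (((hlim.pow 2).mul_const R).mul_const (∫ x, φ x ^ 2))
        simpa [Function.comp_def] using h4
      refine squeeze_zero_norm (fun i => ?_) h3
      rw [Real.norm_eq_abs]
      refine Real.abs_le_sqrt ((sq_integral_mul_le (hI.memLp_sub_paInterp (hε i) (hu i)) hφ).trans
        (mul_le_mul_of_nonneg_right ?_ (integral_sq_nonneg _ _)))
      exact (hI.integral_sq_sub_paInterp_le (hε i) (hu i)).trans
        (mul_le_mul_of_nonneg_left (hR' i) (sq_nonneg _))
    have h3 : ∀ i, ∫ x, I (ε i) (u i) x * φ x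
        = (∫ x, prim (pcInterp (ε i) (diffQuot (ε i) (u i))) x * φ x)
          + ∫ x, (I (ε i) (u i) x - paInterp (ε i) (u i) x) * φ x := by
      intro i
      rw [← integral_add (integrable_mul_of_memLp_two (hD i).memLp_prim hφ)
        (integrable_mul_of_memLp_two (hI.memLp_sub_paInterp (hε i) (hu i)) hφ),
        (hu i).paInterp_eq_prim (hε i)]
      congr 1; ext x; ring
    have h4 := h1.add h2
    simp only [← h3, add_zero] at h4
    simpa [mul_comm] using tendsto_nhds_unique (hw φ hφ) h4
  · obtain ⟨s, C, hsm, hC, hs, hsC⟩ := exists_subgradient hf hc₁ hc₂ hf_lower hf_upper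
    have hfc := continuous_of_convexOn_univ hf
    have hKg : MemLp (fun x => K * g x) 2 volume := hgm.const_mul K
    have hKg0 : ∀ᵐ x, x ∉ Ioo a b → K * g x = 0 :=
      hG.ae_zero.mono fun x hx h => by rw [hx h, mul_zero]
    have hKg0' : ∀ᵐ x, x ∉ Ioo (a - 1) (b + 1) → K * g x = 0 :=
      hG'.ae_zero.mono fun x hx h => by rw [hx h, mul_zero]
    set h := (Ioo (a - 1) (b + 1)).indicator fun x => s (K * g x)
    have hhm : MemLp h 2 volume := memLp_subgradient hsm hC hsC hKg _ _
    have h1 := tendsto_integral_grad_mul hK hε hlim (fun i => (hu i).finite_support (hε i)) hR' hhm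
      (hg h hhm)
    have h2 := tendsto_mul_ncard_activeSites hM hab hε hlim
    have h3 : ∀ i, (∫ x, (f (K * g x) - f 0))
        + ((∫ x, pcInterp (ε i) (grad M ρ (ε i) (u i)) x * h x) - ∫ x, K * g x * h x) + f 0 * (ε i * (activeSites M a b (ε i)).ncard) ≤ c := by
      intro i
      refine le_trans ?_ (hE i)
      rw [activeEnergy_eq hM ρ f (hε i) (hu i)]
      gcongr
      refine density_integral_ge hfc hsm hs hC hsC hKg hKg0' (memLp_pcInterp (hε i)
        (finite_support_grad ((hu i).finite_support (hε i)) M ρ (ε i)))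
        (Eventually.of_forall fun x hx => pcInterp_grad_eq_zero hM (hε i) (hu i) fun hx' =>
          hx (Ioo_subset_Ioo ?_ ?_ hx')) <;> linarith [hMε i]
    have h4 := le_of_tendsto' (((h1.sub_const (∫ x, K * g x * h x)).const_add
      (∫ x, (f (K * g x) - f 0))).add (h2.const_mul (f 0))) h3
    have h5 : ∫ x, K * g x * h x = K * ∫ x, g x * h x := by
      rw [← integral_const_mul]; congr 1; ext x; ring
    rw [h5, sub_self, add_zero] at h4
    rwa [setIntegral_density_eq hfc hs hC hsC hab.le hKg hKg0]

/-! ### Recovery sequences -/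

/-- Jensen's inequality on an interval. -/
theorem map_intervalIntegral_div_le {F v : ℝ → ℝ} (hF : ConvexOn ℝ Set.univ F) {p q : ℝ}
    (hpq : p < q) (hv : Integrable v volume) (hFv : Integrable (fun x => F (v x)) volume) :
    F ((∫ x in p..q, v x) / (q - p)) ≤ (∫ x in p..q, F (v x)) / (q - p) := by
  have h := hF.map_set_average_le (μ := volume) (t := Ioc p q) (f := v)
    (continuous_of_convexOn_univ hF).continuousOn isClosed_univ (by simp [hpq]) (by simp)
    (Eventually.of_forall fun _ => mem_univ _) hv.integrableOn hFv.integrableOn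
  rw [setAverage_eq, setAverage_eq, Real.volume_real_Ioc_of_le hpq.le,
    ← intervalIntegral.integral_of_le hpq.le, ← intervalIntegral.integral_of_le hpq.le,
    smul_eq_mul, smul_eq_mul] at h
  rwa [div_eq_inv_mul, div_eq_inv_mul]

/-- Blocks of `2 j + 1` consecutive cells, one around each lattice point, cover the line
`2 j + 1` times. -/
theorem hasSum_integral_blocks {h : ℝ → ℝ} (hh : Integrable h volume) {ε : ℝ} (hε : 0 < ε)
    (j : ℕ) :
    HasSum (fun k : ℤ => ∫ x in ε * (k + (-j : ℤ) : ℤ)..ε * (k + (j + 1 : ℤ) : ℤ), h x)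
      ((2 * j + 1) * ∫ x, h x) := by
  have h1 : ∀ k : ℤ, ∫ x in ε * (k + (-j : ℤ) : ℤ)..ε * (k + (j + 1 : ℤ) : ℤ), h x
      = ∑ i ∈ Finset.range (2 * j + 1),
        ∫ x in ε * ((k + (i - j) : ℤ) : ℝ)..ε * (((k + (i - j) : ℤ) : ℝ) + 1), h x := by
    intro k
    have := intervalIntegral.sum_integral_adjacent_intervals (f := h) (μ := volume)
      (a := fun i : ℕ => ε * ((k + (i - j) : ℤ) : ℝ)) (n := 2 * j + 1)
      fun i _ => hh.intervalIntegrable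
    rw [show ((k + (j + 1) : ℤ) : ℝ) = ((k + ((2 * j + 1 : ℕ) - j) : ℤ) : ℝ) by
      push_cast; ring, show ((k + -j : ℤ) : ℝ) = ((k + ((0 : ℕ) - j) : ℤ) : ℝ) by
      push_cast; ring, ← this]
    refine Finset.sum_congr rfl fun i _ => ?_
    congr 2
    push_cast; ring
  have h2 : ∀ i ∈ Finset.range (2 * j + 1), HasSum (fun k : ℤ =>
      ∫ x in ε * ((k + (i - j) : ℤ) : ℝ)..ε * (((k + (i - j) : ℤ) : ℝ) + 1), h x)
      (∫ x, h x) := fun i _ =>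
    (Equiv.addRight ((i : ℤ) - j)).hasSum_iff.2 (hasSum_integral_cells hh hε)
  have h3 := hasSum_sum h2
  simp only [← h1] at h3
  simpa using h3

/-- Sampling the primitive of `g` does not increase the energy, up to the contribution of the
constant `f 0`: the nonlocal gradients of the samples are weighted averages of `K g`, and Jensen's
inequality applies. -/
theorem activeEnergy_sample_le {M : ℕ} (hM : 1 ≤ M) {ρ : ℕ → ℝ}
    (hρ_pos : ∀ i ∈ Set.Icc 1 M, 0 < ρ i)
    {f : ℝ → ℝ} (hf : ConvexOn ℝ Set.univ f) {a b : ℝ} {K : ℝ}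
    (hK : K = ∑ j ∈ Finset.Icc 1 M, (2 * (j : ℝ) - 1) * ρ j) {ε : ℝ} (hε : 0 < ε) {g : ℝ → ℝ}
    (hg : IsGradOn a b g) (hfg : Integrable (fun x => f (K * g x) - f 0) volume)
    (hu : VanishesOutside a b ε fun k => prim g (ε * k)) :
    activeEnergy M ρ f a b ε (fun k => prim g (ε * k))
      ≤ (∫ x, (f (K * g x) - f 0)) + f 0 * (ε * (activeSites M a b ε).ncard) := by
  set u : ℤ → ℝ := fun k => prim g (ε * k)
  rw [activeEnergy_eq hM ρ f hε hu]
  refine add_le_add ?_ le_rfl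
  have hfin := finite_support_comp (F := fun z => f z - f 0)
    (finite_support_grad (hu.finite_support hε) M ρ ε) (sub_self _)
  change ∫ x, pcInterp ε (fun k => f (grad M ρ ε u k) - f 0) x ≤ _
  rw [integral_pcInterp hε hfin]
  have hρ : ∀ j ∈ Finset.range M, 0 < ρ (j + 1) := fun j hj =>
    hρ_pos _ ⟨by omega, Finset.mem_range.1 hj⟩
  have hKs := sum_weights_eq hK
  have hKpos : 0 < K := by
    rw [hKs]
    exact Finset.sum_pos (fun j hj => mul_pos (hρ j hj) (by positivity))
      ⟨0, Finset.mem_range.2 hM⟩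
  have hF : ConvexOn ℝ Set.univ fun z => f z - f 0 := by
    have := hf.add_const (-f 0)
    simp only [Pi.add_def, ← sub_eq_add_neg] at this
    exact this
  have hpt : ∀ k : ℤ, ε * (f (grad M ρ ε u k) - f 0) ≤ ∑ j ∈ Finset.range M, ρ (j + 1) / K *
      ∫ x in ε * (k + (-j : ℤ) : ℤ)..ε * (k + (j + 1 : ℤ) : ℤ), (f (K * g x) - f 0) := by
    intro k
    set P : ℕ → ℝ := fun j => ε * (k + (-j : ℤ) : ℤ) with hP
    set Q : ℕ → ℝ := fun j => ε * (k + (j + 1 : ℤ) : ℤ) with hQ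
    have hPQ : ∀ j, Q j - P j = ε * (2 * j + 1) := fun j => by
      simp only [hP, hQ]; push_cast; ring
    have hlt : ∀ j, P j < Q j := fun j => by
      have : 0 < ε * (2 * (j : ℝ) + 1) := by positivity
      linarith [hPQ j]
    have hgrad : grad M ρ ε u k = ∑ j ∈ Finset.range M, (ρ (j + 1) * (2 * j + 1) / K) •
        ((∫ x in P j..Q j, K * g x) / (Q j - P j)) := by
      rw [grad_eq, Finset.mul_sum]
      refine Finset.sum_congr rfl fun j _ => ?_
      have : u (k + (j + 1)) - u (k + (-j)) = ∫ x in P j..Q j, g x := by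
        rw [← prim_sub_prim hg.integrable]
      rw [this, hPQ, intervalIntegral.integral_const_mul, smul_eq_mul]
      have : (2 * (j : ℝ) + 1) ≠ 0 := by positivity
      field_simp
    rw [hgrad]
    have h1 := hF.map_sum_le (t := Finset.range M) (w := fun j => ρ (j + 1) * (2 * j + 1) / K)
      (p := fun j => (∫ x in P j..Q j, K * g x) / (Q j - P j))
      (fun j hj => (div_pos (mul_pos (hρ j hj) (by positivity)) hKpos).le)
      (by rw [← Finset.sum_div, ← hKs, div_self hKpos.ne']) (fun _ _ => mem_univ _)
    refine (mul_le_mul_of_nonneg_left h1 hε.le).trans ?_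
    rw [Finset.mul_sum]
    refine Finset.sum_le_sum fun j hj => ?_
    have h2 := map_intervalIntegral_div_le hF (hlt j) (hg.integrable.const_mul K) hfg
    have h3 : 0 ≤ ε * (ρ (j + 1) * (2 * j + 1) / K) :=
      mul_nonneg hε.le (div_pos (mul_pos (hρ j hj) (by positivity)) hKpos).le
    rw [smul_eq_mul, ← mul_assoc]
    refine (mul_le_mul_of_nonneg_left h2 h3).trans_eq ?_
    rw [hPQ]
    have : (2 * (j : ℝ) + 1) ≠ 0 := by positivity
    field_simp
    rfl
  have hsum := hasSum_sum fun j (_ : j ∈ Finset.range M) =>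
    (hasSum_integral_blocks hfg hε j).mul_left (ρ (j + 1) / K)
  have hfin' : Summable fun k : ℤ => ε * (f (grad M ρ ε u k) - f 0) :=
    (summable_of_finite hfin).mul_left ε
  refine (hasSum_le hpt hfin'.hasSum hsum).trans_eq ?_
  have e : ∀ j ∈ Finset.range M, ρ (j + 1) / K * ((2 * j + 1) * ∫ x, (f (K * g x) - f 0))
      = (ρ (j + 1) * (2 * j + 1)) * ((∫ x, (f (K * g x) - f 0)) / K) := fun j _ => by ring
  rw [Finset.sum_congr rfl e, ← Finset.sum_mul, ← hKs]
  field_simp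

/-- Interpolations of the samples of a primitive converge in `L²` as the scale vanishes. -/
theorem IsInterp.integral_sq_sample_sub_le {I : ℝ → (ℤ → ℝ) → ℝ → ℝ} (hI : IsInterp I) {a b ε : ℝ}
    (hab : a < b) (hε : 0 < ε) {g : ℝ → ℝ} (hg : IsGradOn a b g)
    (hu : VanishesOutside a b ε fun k => prim g (ε * k)) :
    ∫ x, (I ε (fun k => prim g (ε * k)) x - prim g x) ^ 2
      ≤ (b - a + 2 * ε) * (4 * ε * ∫ x, g x ^ 2) := by
  have hint : Integrable ((Ioo (a - ε) (b + ε)).indicator fun _ => 4 * ε * ∫ x, g x ^ 2) volume :=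
    (integrable_indicator_iff measurableSet_Ioo).2 (integrableOn_const (by simp))
  refine (integral_mono ((hI.memLp hε hu).sub hg.memLp_prim).integrable_sq hint
    fun x => ?_).trans_eq ?_
  · have h0 := hI.abs_sub_le ε (fun k => prim g (ε * k)) x
    have h1 := mul_floor_div_le hε x
    have h2 := lt_mul_floor_div_add_one hε x
    have hG := integral_sq_nonneg volume g
    simp only [Pi.sub_apply]
    by_cases hx : x ∈ Ioo (a - ε) (b + ε)
    · rw [indicator_of_mem hx]
      have h3 := pow_le_pow_left₀ (abs_nonneg _) h0 2
      rw [sq_abs, sq_abs] at h3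
      have h4 := sq_prim_sub_prim_le hg.memLp hg.integrable (ε * ⌊x / ε⌋)
        (ε * (⌊x / ε⌋ + 1 : ℤ))
      have h5 := sq_prim_sub_prim_le hg.memLp hg.integrable (ε * ⌊x / ε⌋) x
      have e1 : |ε * ((⌊x / ε⌋ + 1 : ℤ) : ℝ) - ε * ⌊x / ε⌋| = ε := by
        push_cast
        rw [show ε * ((⌊x / ε⌋ : ℝ) + 1) - ε * ⌊x / ε⌋ = ε by ring, abs_of_pos hε]
      have e2 : |x - ε * ⌊x / ε⌋| ≤ ε := by rw [abs_le]; constructor <;> linarith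
      rw [e1] at h4
      have h6 := mul_le_mul_of_nonneg_right e2 hG
      have h7 := add_sq_le (a := I ε (fun k => prim g (ε * k)) x - prim g (ε * ⌊x / ε⌋))
        (b := prim g (ε * ⌊x / ε⌋) - prim g x)
      rw [sub_add_sub_cancel] at h7
      nlinarith
    · have e1 : prim g (ε * ⌊x / ε⌋) = 0 :=
        hg.prim_eq_zero fun h => hx ⟨by linarith [h.1], by linarith [h.2]⟩
      have e2 : prim g (ε * (⌊x / ε⌋ + 1 : ℤ)) = 0 := hg.prim_eq_zero fun h => by
        push_cast at h
        exact hx ⟨by linarith [h.1], by linarith [h.2]⟩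
      have e3 : prim g x = 0 :=
        hg.prim_eq_zero fun h => hx ⟨by linarith [h.1], by linarith [h.2]⟩
      rw [e1, e2, sub_zero, sub_zero, abs_zero, abs_nonpos_iff] at h0
      rw [indicator_of_notMem hx, h0, e3]
      simp
  · rw [integral_indicator measurableSet_Ioo, setIntegral_const,
      Real.volume_real_Ioo_of_le (by linarith), smul_eq_mul]
    ring

/-! ### Γ-convergence and equicoercivity -/

theorem limitFunctional_eq {f : ℝ → ℝ} {K a b : ℝ} {w : Lp ℝ 2 (volume : Measure ℝ)} {g : ℝ → ℝ}
    (hw : MemH10 a b w) (hg : weakDeriv w =ᵐ[volume] g) :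
    limitFunctional f K a b w = ((∫ t in Ioo a b, f (K * g t) : ℝ) : EReal) := by
  rw [limitFunctional, if_pos hw]
  congr 1
  refine integral_congr_ae (ae_restrict_of_ae ?_)
  filter_upwards [hg] with x hx
  rw [hx]

theorem isWeakGammaLimit_activeEnergy {M : ℕ} (hM : 1 ≤ M) {ρ : ℕ → ℝ}
    (hρ_pos : ∀ i ∈ Set.Icc 1 M, 0 < ρ i) (hρ_anti : StrictAntiOn ρ (Set.Icc 1 M))
    {f : ℝ → ℝ} (hf : ConvexOn ℝ Set.univ f) {c₀ c₁ c₂ c₃ : ℝ} (hc₁ : 0 < c₁) (hc₂ : 0 < c₂)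
    (hf_lower : ∀ z, c₁ * |z| ^ 2 + c₀ ≤ f z) (hf_upper : ∀ z, f z ≤ c₂ * |z| ^ 2 + c₃)
    {a b : ℝ} (hab : a < b) {K : ℝ} (hK : K = ∑ j ∈ Finset.Icc 1 M, (2 * (j : ℝ) - 1) * ρ j)
    {I : ℝ → (ℤ → ℝ) → ℝ → ℝ} (hI : IsInterp I) :
    IsWeakGammaLimit (onL2 a b I (activeEnergy M ρ f a b)) (limitFunctional f K a b) := by
  intro ε hε hlim w
  constructor
  · intro v hv
    by_contra hcon
    obtain ⟨c, hc1, hc2⟩ := EReal.lt_iff_exists_real_btwn.1 (not_le.1 hcon)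
    have hMpos : (0 : ℝ) < 1 / (2 * M) := by
      have : (0 : ℝ) < M := by exact_mod_cast hM
      positivity
    -- the indices of small scale and energy below `c` form an unbounded set
    have hfreq := (frequently_lt_of_liminf_lt (by isBoundedDefault) hc1).and_eventually
      (hlim.eventually (gt_mem_nhds hMpos))
    set S : Set ℕ := {n | onL2 a b I (activeEnergy M ρ f a b) (ε n) (v n) < c ∧
      ε n < 1 / (2 * M)} with hS
    have hne : (comap (Subtype.val : S → ℕ) atTop).NeBot := by
      rw [comap_neBot_iff_frequently, Subtype.range_coe]
      exact hfreq
    have hU : Tendsto (Subtype.val : S → ℕ)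
        (Ultrafilter.of (comap (Subtype.val : S → ℕ) atTop)) atTop :=
      tendsto_comap.mono_left (Ultrafilter.of_le _)
    have hex : ∀ n : S, ∃ u : ℤ → ℝ, VanishesOutside a b (ε n) u ∧ I (ε n) u =ᵐ[volume] v n ∧
        activeEnergy M ρ f a b (ε n) u ≤ c := by
      intro n
      have h1 := n.2.1
      simp only [onL2, iInf_lt_iff] at h1
      obtain ⟨u, ⟨h2, h3⟩, h4⟩ := h1
      exact ⟨u, h2, h3, (EReal.coe_lt_coe_iff.1 h4).le⟩
    choose u hu1 hu2 hu3 using hex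
    obtain ⟨g, hg, hwg, hle⟩ := exists_isGradOn_of_energy_le hM hρ_pos hρ_anti hf hc₁ hc₂ hf_lower
      hf_upper hab hK hI (Ultrafilter.of (comap (Subtype.val : S → ℕ) atTop))
      (ε := fun n : S => ε n) (fun n => hε n) (fun n => n.2.2) (hlim.comp hU) hu1 hu3 (Lp.memLp w)
      (fun φ hφ => ((tendsto_integral_of_tendsto_weak hv hφ).comp hU).congr fun n => by
        refine integral_congr_ae ?_
        filter_upwards [hu2 n] with x hx
        rw [hx])
    have hH := hg.memH10 hab hwg
    obtain ⟨-, h2, h3⟩ := hg.isWeakDeriv hab.le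
    have hwd : IsWeakDeriv w g := by
      refine ⟨(Lp.memLp w).locallyIntegrable one_le_two, h2, fun φ k1 k2 => ?_⟩
      rw [← h3 φ k1 k2]
      refine integral_congr_ae ?_
      filter_upwards [hwg] with x hx
      rw [hx]
    rw [limitFunctional_eq hH (hwd.weakDeriv_ae_eq hg.memLp), EReal.coe_lt_coe_iff] at hc2
    linarith
  · by_cases hH : MemH10 a b w
    swap
    · refine ⟨fun _ => w, tendsto_const_nhds, ?_⟩
      rw [limitFunctional, if_neg hH]
      exact le_top
    obtain ⟨g, hg, hwg, hwd⟩ := hH.exists_isGradOn hab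
    obtain ⟨s, C, -, hC, hs, hsC⟩ := exists_subgradient hf hc₁ hc₂ hf_lower hf_upper
    have hfc := continuous_of_convexOn_univ hf
    have hKg : MemLp (fun x => K * g x) 2 volume := hg.memLp.const_mul K
    have hKg0 : ∀ᵐ x, x ∉ Ioo a b → K * g x = 0 :=
      hg.ae_zero.mono fun x hx h => by rw [hx h, mul_zero]
    have hfg := integrable_density hfc hs hC hsC (hg.integrable.const_mul K) hKg
    have hu : ∀ n, VanishesOutside a b (ε n) fun k => prim g (ε n * k) := fun n k hk =>
      hg.prim_eq_zero hk
    have hm : ∀ n, MemLp (I (ε n) fun k => prim g (ε n * k)) 2 volume := fun n =>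
      hI.memLp (hε n) (hu n)
    refine ⟨fun n => (hm n).toLp _, ?_, ?_⟩
    · refine ((toWeakSpaceCLM ℝ (Lp ℝ 2 (volume : Measure ℝ))).continuous.tendsto w).comp ?_
      have hw' : w = hg.memLp_prim.toLp (prim g) :=
        Lp.ext (hwg.trans hg.memLp_prim.coeFn_toLp.symm)
      rw [tendsto_iff_norm_sub_tendsto_zero, hw']
      have h1 : Tendsto (fun n => √((b - a + 2 * ε n) * (4 * ε n * ∫ x, g x ^ 2))) atTop
          (𝓝 0) := by
        have h2 := (Real.continuous_sqrt.tendsto _).comp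
          (((hlim.const_mul 2).const_add (b - a)).mul
            ((hlim.const_mul 4).mul_const (∫ x, g x ^ 2)))
        simpa [Function.comp_def] using h2
      refine squeeze_zero (fun n => norm_nonneg _) (fun n => ?_) h1
      refine Real.le_sqrt_of_sq_le ?_
      rw [← MemLp.toLp_sub, norm_sq_toLp]
      exact hI.integral_sq_sample_sub_le hab (hε n) hg (hu n)
    · rw [limitFunctional_eq hH hwd, setIntegral_density_eq hfc hs hC hsC hab.le hKg hKg0]
      have h1 : Tendsto (fun n => (((∫ x, (f (K * g x) - f 0))
          + f 0 * (ε n * (activeSites M a b (ε n)).ncard) : ℝ) : EReal)) atTop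
          (𝓝 (((∫ x, (f (K * g x) - f 0)) + f 0 * (b - a) : ℝ) : EReal)) :=
        (continuous_coe_real_ereal.tendsto _).comp
          (((tendsto_mul_ncard_activeSites hM hab hε hlim).const_mul (f 0)).const_add _)
      rw [← h1.limsup_eq]
      refine limsup_le_limsup (Eventually.of_forall fun n => ?_)
      have hadm : VanishesOutside a b (ε n) (fun k => prim g (ε n * k)) ∧
          I (ε n) (fun k => prim g (ε n * k)) =ᵐ[volume] (hm n).toLp _ :=
        ⟨hu n, (hm n).coeFn_toLp.symm⟩
      refine le_trans (iInf₂_le (fun k : ℤ => prim g (ε n * k)) hadm) ?_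
      exact EReal.coe_le_coe_iff.2 (activeEnergy_sample_le hM hρ_pos hf hK (hε n) hg hfg (hu n))

theorem equicoerciveH1_activeEnergy {M : ℕ} (hM : 1 ≤ M) {ρ : ℕ → ℝ}
    (hρ_pos : ∀ i ∈ Set.Icc 1 M, 0 < ρ i) (hρ_anti : StrictAntiOn ρ (Set.Icc 1 M))
    {f : ℝ → ℝ} {c₀ c₁ : ℝ} (hc₁ : 0 < c₁) (hf_lower : ∀ z, c₁ * |z| ^ 2 + c₀ ≤ f z)
    {a b : ℝ} (hab : a < b) :
    EquicoerciveH1 a b (1 / (2 * M)) (activeEnergy M ρ f a b) := by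
  intro C
  obtain ⟨R, hR⟩ := exists_bound_diffQuot hM hρ_pos hρ_anti hc₁ hf_lower hab C
  refine ⟨(b - a + 1) ^ 2 * R + R, fun ε hε hεM u hu hE => ?_⟩
  have h1 := hR ε hε hεM u hu hE
  have hG := hu.isGradOn hε
  have hε2 : ε < 1 / 2 := by
    refine hεM.trans_le (one_div_le_one_div_of_le two_pos ?_)
    have : (1 : ℝ) ≤ M := by exact_mod_cast hM
    linarith
  rw [hu.paInterp_eq_prim hε]
  refine ⟨pcInterp ε (diffQuot ε u), hG.isWeakDeriv (by linarith), hG.memLp_prim, hG.memLp,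
    add_le_add ((hG.integral_sq_prim_le (by linarith)).trans ?_) h1⟩
  exact mul_le_mul (pow_le_pow_left₀ (by linarith) (by linarith) 2) h1 (integral_sq_nonneg _ _)
    (by positivity)

end NonlocalGradient

end

theorem mainTheorem3 (M : ℕ) (hM : 1 ≤ M) (ρ : ℕ → ℝ)
    (hρ_pos : ∀ i ∈ Set.Icc 1 M, 0 < ρ i) (hρ_anti : StrictAntiOn ρ (Set.Icc 1 M))
    (f : ℝ → ℝ) (hf : ConvexOn ℝ Set.univ f)
    (c₀ c₁ c₂ c₃ : ℝ) (hc₁ : 0 < c₁) (hc₂ : 0 < c₂)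
    (hf_lower : ∀ z, c₁ * |z| ^ 2 + c₀ ≤ f z) (hf_upper : ∀ z, f z ≤ c₂ * |z| ^ 2 + c₃)
    (a b : ℝ) (hab : a < b) (K : ℝ) (hK : K = ∑ j ∈ Finset.Icc 1 M, (2 * (j : ℝ) - 1) * ρ j) :
    -- the sum over all sites `k ∈ ℤ`, meaningful when `f 0 = 0`
    (f 0 = 0 →
      NonlocalGradient.IsWeakGammaLimit
        (NonlocalGradient.onL2 a b NonlocalGradient.pcInterp
          (NonlocalGradient.fullEnergy M ρ f))
        (NonlocalGradient.limitFunctional f K a b) ∧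
      NonlocalGradient.IsWeakGammaLimit
        (NonlocalGradient.onL2 a b NonlocalGradient.paInterp
          (NonlocalGradient.fullEnergy M ρ f))
        (NonlocalGradient.limitFunctional f K a b) ∧
      NonlocalGradient.EquicoerciveH1 a b (1 / (2 * M))
        (NonlocalGradient.fullEnergy M ρ f)) ∧
    -- arbitrary `f 0`, the sum over the sites whose gradient involves `(a, b)`
    (NonlocalGradient.IsWeakGammaLimit
        (NonlocalGradient.onL2 a b NonlocalGradient.pcInterp
          (NonlocalGradient.activeEnergy M ρ f a b))
        (NonlocalGradient.limitFunctional f K a b) ∧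
      NonlocalGradient.IsWeakGammaLimit
        (NonlocalGradient.onL2 a b NonlocalGradient.paInterp
          (NonlocalGradient.activeEnergy M ρ f a b))
        (NonlocalGradient.limitFunctional f K a b) ∧
      NonlocalGradient.EquicoerciveH1 a b (1 / (2 * M))
        (NonlocalGradient.activeEnergy M ρ f a b)) := by
  have hact : ∀ I, NonlocalGradient.IsInterp I → NonlocalGradient.IsWeakGammaLimit
      (NonlocalGradient.onL2 a b I (NonlocalGradient.activeEnergy M ρ f a b))
      (NonlocalGradient.limitFunctional f K a b) := fun I hI =>
    NonlocalGradient.isWeakGammaLimit_activeEnergy hM hρ_pos hρ_anti hf hc₁ hc₂ hf_lower hf_upper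
      hab hK hI
  have hco := NonlocalGradient.equicoerciveH1_activeEnergy hM hρ_pos hρ_anti hc₁ hf_lower hab
  refine ⟨fun h0 => ?_, hact _ NonlocalGradient.isInterp_pcInterp,
    hact _ NonlocalGradient.isInterp_paInterp, hco⟩
  have hfull : ∀ I, NonlocalGradient.IsInterp I → NonlocalGradient.IsWeakGammaLimit
      (NonlocalGradient.onL2 a b I (NonlocalGradient.fullEnergy M ρ f))
      (NonlocalGradient.limitFunctional f K a b) := by
    intro I hI ε hε hlim w
    have e : ∀ n, NonlocalGradient.onL2 a b I (NonlocalGradient.fullEnergy M ρ f) (ε n)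
        = NonlocalGradient.onL2 a b I (NonlocalGradient.activeEnergy M ρ f a b) (ε n) := by
      intro n
      funext v
      refine iInf_congr fun u => iInf_congr fun hu => ?_
      rw [NonlocalGradient.fullEnergy_eq_activeEnergy hM h0 hu.1]
    simpa only [e] using hact I hI ε hε hlim w
  refine ⟨hfull _ NonlocalGradient.isInterp_pcInterp, hfull _ NonlocalGradient.isInterp_paInterp,
    fun C => ?_⟩
  obtain ⟨R, hR⟩ := hco C
  exact ⟨R, fun ε hε hεM u hu hE => hR ε hε hεM u hu
    ((NonlocalGradient.fullEnergy_eq_activeEnergy hM h0 hu).symm.trans_le hE)⟩
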